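/- Let $p,q\in(0,1)$ with $p^2+q^2=1$ and $r\in(0,\tfrac1q)$, and put $a:=\sqrt{1+r^2p^2}$, $b:=1$, $c:=\sqrt{1-r^2q^2}$, so that $a>b>c>0$. Let $\mathrm{sn}_k,\mathrm{cn}_k,\mathrm{dn}_k$ denote the Jacobi elliptic functions with module $k$, and let $\Omega\subset\mathbb C$ be the complex plane without the zeros of $\mathrm{dn}_p$. For $z=u+iv\in\Omega$ let $$X(z)=\big(a\,\mathrm{sn}_pu\,\mathrm{dn}_qv,\;-b\,\mathrm{cn}_pu\,\mathrm{cn}_qv,\;-c\,\mathrm{dn}_pu\,\mathrm{sn}_qv\big).$$ Then $X$ is a curvature line parametrization (a smooth immersion with $(u,v)$ orthogonal and conjugate) and $X(\Omega)$ is the tri-axial ellipsoid with half axes $a,b,c$ without its four umbilics $(\pm ap,0,\pm cq)$. The Christoffel dual of this ellipsoid is an affine image of a Scherk tower, namely the multi-valued map $$z\mapsto \mathrm{Re}\begin{pmatrix}\frac{2a}{p}\,\mathrm{artanh}\frac{1}{p\,\mathrm{sn}_p}\\[2pt] \frac{2b}{pq}\,\arctan\frac{q}{p\,\mathrm{cn}_p}\\[2pt]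 \frac{2c}{q}\,\mathrm{artanh}\Big(\frac qi\,\frac{\mathrm{sn}_p}{\mathrm{cn}_p}\Big)\end{pmatrix}(z),\qquad z\in\Omega,$$ whose second component is defined up to multiples of $\frac{2\pi b}{pq}$ (at zeros and poles of $\mathrm{sn}_p,\mathrm{cn}_p$ it is extended by continuity). In detail: (i) On every simply connected open $U\subset\Omega$ this map has a continuous branch. (ii) If $Y$ is a continuous branch on an open set $U\subset\Omega$, then $Y$ is a Christoffel dual of $X|_U$, that is, $X$ and $Y$ are smooth immersions with parallel tangent planes that are conformally related, with $dX^{-1}\circ dY$ orientation reversing; also $(u,v)$ are curvature line parameters of $Y$. If $U$ is connected, then the Christoffel duals of $X|_U$ are exactly the maps $sY+t$ with $s\in\mathbb R\setminus\{0\}$ and $t\in\mathbb R^3$. (iii) The union of the images of all continuous branches $Y:U\to\mathbb R^3$, $U\subset\Omega$ open, is the image under the linear map $(x_1,x_2,x_3)\mapsto(ax_1,bx_2,cx_3)$ of the Scherk tower $$\{x\in\mathbb R^3 : q^2\cosh(px_1)+\cos(pqx_2)-p^2\cosh(qx_3)=0\}.$$ -/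

import Mathlib

open scoped ContDiff

noncomputable section

/-! ### Jacobi elliptic functions -/

/-- The incomplete elliptic integral of the first kind with module `k`. -/
def ellipticF (k φ : ℝ) : ℝ := ∫ θ in (0 : ℝ)..φ, 1 / √(1 - k ^ 2 * Real.sin θ ^ 2)

/-- For a module `k ∈ (0, 1)` the elliptic integral is a bijection of the real line, so that
the Jacobi amplitude below is its inverse function. -/
theorem ellipticF_bijective {k : ℝ} (hk : k ∈ Set.Ioo (0 : ℝ) 1) :
    Function.Bijective (ellipticF k) := by
  have hpos : ∀ θ : ℝ, 0 < 1 - k ^ 2 * Real.sin θ ^ 2 := by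
    intro θ
    have h1 : k ^ 2 < 1 := by nlinarith [hk.1, hk.2]
    nlinarith [Real.sin_sq_le_one θ, sq_nonneg (Real.sin θ), sq_nonneg k]
  have hc : Continuous fun θ : ℝ => 1 / √(1 - k ^ 2 * Real.sin θ ^ 2) := by
    refine Continuous.div continuous_const (by fun_prop) ?_
    intro θ
    exact (Real.sqrt_pos.2 (hpos θ)).ne'
  have hd : ∀ φ : ℝ, HasDerivAt (ellipticF k) (1 / √(1 - k ^ 2 * Real.sin φ ^ 2)) φ :=
    fun φ => hc.integral_hasStrictDerivAt 0 φ |>.hasDerivAt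
  have hge : ∀ φ : ℝ, 1 ≤ 1 / √(1 - k ^ 2 * Real.sin φ ^ 2) := by
    intro φ
    rw [le_div_iff₀ (Real.sqrt_pos.2 (hpos φ)), one_mul]
    refine Real.sqrt_le_iff.2 ⟨zero_le_one, ?_⟩
    nlinarith [mul_nonneg (sq_nonneg k) (sq_nonneg (Real.sin φ))]
  have hcont : Continuous (ellipticF k) :=
    continuous_iff_continuousAt.2 fun φ => (hd φ).continuousAt
  have hmono : Monotone fun φ : ℝ => ellipticF k φ - φ := by
    have hd' : ∀ φ : ℝ, HasDerivAt (fun φ : ℝ => ellipticF k φ - φ)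
        (1 / √(1 - k ^ 2 * Real.sin φ ^ 2) - 1) φ := fun φ => (hd φ).sub (hasDerivAt_id φ)
    refine monotone_of_deriv_nonneg (fun φ => (hd' φ).differentiableAt) fun φ => ?_
    rw [(hd' φ).deriv]
    linarith [hge φ]
  have h0 : ellipticF k 0 = 0 := by simp [ellipticF]
  refine ⟨?_, hcont.surjective ?_ ?_⟩
  · refine StrictMono.injective fun x y hxy => ?_
    have := hmono hxy.le
    simp only at this
    linarith
  · refine Filter.tendsto_atTop_mono' _ ?_ Filter.tendsto_id
    filter_upwards [Filter.eventually_ge_atTop (0 : ℝ)] with x hx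
    have := hmono hx
    simp only [h0, id] at this ⊢
    linarith
  · refine Filter.tendsto_atBot_mono' _ ?_ Filter.tendsto_id
    filter_upwards [Filter.eventually_le_atBot (0 : ℝ)] with x hx
    have := hmono hx
    simp only [h0, id] at this ⊢
    linarith

/-- The Jacobi amplitude with module `k`, on the real line. -/
def jacobiAm (k : ℝ) : ℝ → ℝ := Function.invFun (ellipticF k)

/-- The real function `sn` with module `k`. -/
def snR (k x : ℝ) : ℝ := Real.sin (jacobiAm k x)

/-- The real function `cn` with module `k`. -/
def cnR (k x : ℝ) : ℝ := Real.cos (jacobiAm k x)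

/-- The real function `dn` with module `k`. -/
def dnR (k x : ℝ) : ℝ := √(1 - k ^ 2 * snR k x ^ 2)

/-- The common denominator of the Jacobi elliptic functions with module `p` at `z = u + iv`;
it vanishes exactly at their poles. -/
def jacobiDenom (p q : ℝ) (z : ℂ) : ℝ :=
  cnR q z.im ^ 2 + p ^ 2 * snR p z.re ^ 2 * snR q z.im ^ 2

/-- The meromorphic Jacobi function `sn` with module `p` (and complementary module `q`, that is
`p ^ 2 + q ^ 2 = 1`) on the complex plane, by the addition formula and Jacobi's imaginary
transformation. At the poles the value is `0`, as for meromorphic functions in Mathlib. -/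
def jacobiSn (p q : ℝ) (z : ℂ) : ℂ :=
  ((snR p z.re * dnR q z.im : ℝ) +
    Complex.I * (cnR p z.re * dnR p z.re * snR q z.im * cnR q z.im : ℝ)) / (jacobiDenom p q z : ℝ)

/-- The meromorphic Jacobi function `cn` with module `p` and complementary module `q`; its value
at the poles is `0`. -/
def jacobiCn (p q : ℝ) (z : ℂ) : ℂ :=
  ((cnR p z.re * cnR q z.im : ℝ) -
    Complex.I * (snR p z.re * dnR p z.re * snR q z.im * dnR q z.im : ℝ)) / (jacobiDenom p q z : ℝ)

/-- The principal branch of the complex inverse hyperbolic tangent. -/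
def artanhC (ζ : ℂ) : ℂ := 1 / 2 * Complex.log ((1 + ζ) / (1 - ζ))

/-! ### Surfaces in Euclidean space -/

/-- Euclidean 3-space. -/
abbrev E3 : Type := EuclideanSpace ℝ (Fin 3)

/-- The partial derivative `X_u` of a map of `z = u + iv`. -/
def partialU (X : ℂ → E3) (z : ℂ) : E3 := fderiv ℝ X z 1

/-- The partial derivative `X_v` of a map of `z = u + iv`. -/
def partialV (X : ℂ → E3) (z : ℂ) : E3 := fderiv ℝ X z Complex.I

/-- On `U`, the real coordinates `(u, v)` are curvature line parameters, that is orthogonal and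
conjugate parameters, of the immersion `X`. -/
def IsCurvatureLineParam (X : ℂ → E3) (U : Set ℂ) : Prop :=
  ContDiffOn ℝ ∞ X U ∧ ∀ z ∈ U,
    Function.Injective (fderiv ℝ X z) ∧
    inner ℝ (partialU X z) (partialV X z) = 0 ∧
    partialU (partialV X) z ∈ Submodule.span ℝ {partialU X z, partialV X z}

/-- `Y` is a Christoffel dual of the immersion `X` on the open set `U`: `X` and `Y` are smooth
immersions with parallel tangent planes, that are conformally related, and so that the relation
`dY = dX ∘ A` is orientation reversing. -/
def IsChristoffelPair (X Y : ℂ → E3) (U : Set ℂ) : Prop :=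
  ContDiffOn ℝ ∞ X U ∧ ContDiffOn ℝ ∞ Y U ∧ ∀ z ∈ U,
    Function.Injective (fderiv ℝ X z) ∧
    (∃ A : ℂ →ₗ[ℝ] ℂ, LinearMap.det A < 0 ∧ ∀ h : ℂ, fderiv ℝ Y z h = fderiv ℝ X z (A h)) ∧
    ∃ μ : ℝ, 0 < μ ∧ ∀ h : ℂ, ‖fderiv ℝ Y z h‖ = μ * ‖fderiv ℝ X z h‖

/-- The transformation of Euclidean space that scales the axes by `a`, `b` and `c`. -/
def scaleAxes (a b c : ℝ) (x : E3) : E3 := !₂[a * x 0, b * x 1, c * x 2]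

/-! ### The ellipsoid and the Scherk tower -/

/-- The ellipsoid with half axes `a`, `b` and `c`. -/
def ellipsoid (a b c : ℝ) : Set E3 :=
  {x | (x 0 / a) ^ 2 + (x 1 / b) ^ 2 + (x 2 / c) ^ 2 = 1}

/-- Scherk's singly periodic saddle tower with parameters `p, q`, where `p ^ 2 + q ^ 2 = 1`. -/
def scherkTower (p q : ℝ) : Set E3 :=
  {x | q ^ 2 * Real.cosh (p * x 0) + Real.cos (p * q * x 1) - p ^ 2 * Real.cosh (q * x 2) = 0}

/-- The parametrization of the ellipsoid with half axes `a, b, c` by Jacobi elliptic functions. -/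
def ellipsoidParam (p q a b c : ℝ) (z : ℂ) : E3 :=
  !₂[a * (snR p z.re * dnR q z.im), -b * (cnR p z.re * cnR q z.im),
    -c * (dnR p z.re * snR q z.im)]

/-- The complex plane without the zeros `u + iv` of `dn` with module `p`; the excluded points are
those that the above parametrization maps to umbilics of the ellipsoid. -/
def regularDomain (p q : ℝ) : Set ℂ := {z | cnR p z.re ≠ 0 ∨ cnR q z.im ≠ 0}

/-- `Y` is on the open set `U` a continuous branch of the multi-valued map
`z ↦ Re ((2a/p) artanh (1/(p sn z)), (2b/pq) arctan (q/(p cn z)), (2c/q) artanh ((q/i) sn z/cn z))`.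
Here `Re artanh` is single-valued and `arctan` is determined up to multiples of `π`. Where `sn` or
`cn` has a zero or a pole the value of `Y` is given by continuity. -/
def IsDualBranch (p q a b c : ℝ) (U : Set ℂ) (Y : ℂ → E3) : Prop :=
  IsOpen U ∧ U ⊆ regularDomain p q ∧ ContinuousOn Y U ∧
    ∀ z ∈ U, jacobiSn p q z ≠ 0 → jacobiCn p q z ≠ 0 → ∃ k : ℤ,
      Y z = !₂[(2 * a / p * artanhC (1 / (p * jacobiSn p q z))).re,
        (2 * b / (p * q) * (Complex.arctan (q / (p * jacobiCn p q z)) + k * Real.pi)).re,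
        (2 * c / q * artanhC (q / Complex.I * (jacobiSn p q z / jacobiCn p q z))).re]

end

/-!
Write `s, c₁, d` for `sn, cn, dn` with module `p` at `u`, and `S, C, D` for `sn, cn, dn` with
module `q` at `v`. The function `W = p² c₁² + q² C² = D² - p² s² = d² - q² S²` (`confFactor`) is
positive exactly on the regular domain. For all admissible `r` the parametrization `X` satisfies
`⟨X_u, X_v⟩ = 0`, `|X_u|² = W (1 + r² p² c₁²)`, `|X_v|² = W (1 - r² q² C²)`, and `X_uv` is a
combination of `X_u` and `X_v` (`fderiv_ellipsoidParamV_one`). That the image is the ellipsoid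
without umbilics amounts to solving for elliptic coordinates on the unit sphere
(`exists_elliptic_coordinates`).

The multi-valued formula has the closed form
`(2a/p artanh (p s / D), 2b/(pq) arg (p c₁ + i q C), 2c/q artanh (q S / d))`, where the argument is
taken modulo `π`. By density this describes the branches at every point, including the zeros and
poles of `sn` and `cn` (`isDualBranch_iff`). Hence branches on simply connected sets come from
continuous logarithms of `(p c₁ + i q C)²`, and differentiation gives `Y_u = (2/W) X_u` and
`Y_v = -(2/W) X_v` (`IsDualBranch.hasFDerivAt`), so that `Y` is a Christoffel dual with the same
curvature line parameters.

For uniqueness let `Z` be any Christoffel dual and `dZ = dX ∘ A`. Since `A` is conformal and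
reverses the orientation, its off-diagonal entries satisfy `m' |X_u|² = m |X_v|²`. The symmetry of
`Z_uv` and the normal field `N`, for which `⟨N_u, X_u⟩ = ⟨N_v, X_v⟩ = W`, give `m = m'`. As
`|X_u|² - |X_v|² = r² W²` is nonzero, `m = m' = 0` and `dZ = κ dY` for a function `κ`
(`IsChristoffelPair.exists_fderiv_eq`). The symmetry of second derivatives then forces `dκ = 0`
(`exists_eq_smul_add_of_fderiv_eq_smul`).

Finally `cosh (p x₀) = (D² + p² s²) / W`, `cosh (q x₂) = (d² + q² S²) / W` and
`cos (p q x₁) = (p² c₁² - q² C²) / W` at the point `(a x₀, b x₁, c x₂)` of the dual surface, which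
gives the equation of the Scherk tower, and these relations can be solved for `u` and `v`
(`exists_isDualValue_scaleAxes`).
-/

/-! ### Jacobi elliptic functions on the real line -/

theorem one_sub_sq_mul_sin_sq_pos {k : ℝ} (hk : k ∈ Set.Ioo (0 : ℝ) 1) (θ : ℝ) :
    0 < 1 - k ^ 2 * Real.sin θ ^ 2 := by
  have h1 : k ^ 2 < 1 := by nlinarith [hk.1, hk.2]
  nlinarith [Real.sin_sq_le_one θ, sq_nonneg (Real.sin θ), sq_nonneg k]

theorem hasDerivAt_ellipticF {k : ℝ} (hk : k ∈ Set.Ioo (0 : ℝ) 1) (φ : ℝ) :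
    HasDerivAt (ellipticF k) (1 / √(1 - k ^ 2 * Real.sin φ ^ 2)) φ := by
  have hc : Continuous fun θ : ℝ => 1 / √(1 - k ^ 2 * Real.sin θ ^ 2) :=
    Continuous.div continuous_const (by fun_prop) fun θ =>
      (Real.sqrt_pos.2 (one_sub_sq_mul_sin_sq_pos hk θ)).ne'
  exact (hc.integral_hasStrictDerivAt 0 φ).hasDerivAt

theorem strictMono_ellipticF {k : ℝ} (hk : k ∈ Set.Ioo (0 : ℝ) 1) : StrictMono (ellipticF k) := by
  refine strictMono_of_deriv_pos fun φ => ?_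
  rw [(hasDerivAt_ellipticF hk φ).deriv]
  exact one_div_pos.2 (Real.sqrt_pos.2 (one_sub_sq_mul_sin_sq_pos hk φ))

theorem ellipticF_jacobiAm {k : ℝ} (hk : k ∈ Set.Ioo (0 : ℝ) 1) (x : ℝ) :
    ellipticF k (jacobiAm k x) = x :=
  Function.rightInverse_invFun (ellipticF_bijective hk).2 x

theorem jacobiAm_ellipticF {k : ℝ} (hk : k ∈ Set.Ioo (0 : ℝ) 1) (φ : ℝ) :
    jacobiAm k (ellipticF k φ) = φ :=
  Function.leftInverse_invFun (ellipticF_bijective hk).1 φ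

theorem continuous_jacobiAm {k : ℝ} (hk : k ∈ Set.Ioo (0 : ℝ) 1) : Continuous (jacobiAm k) := by
  refine Monotone.continuous_of_surjective (fun x y hxy => ?_)
    fun φ => ⟨_, jacobiAm_ellipticF hk φ⟩
  rwa [← (strictMono_ellipticF hk).le_iff_le, ellipticF_jacobiAm hk, ellipticF_jacobiAm hk]

theorem hasDerivAt_jacobiAm {k : ℝ} (hk : k ∈ Set.Ioo (0 : ℝ) 1) (x : ℝ) :
    HasDerivAt (jacobiAm k) (dnR k x) x := by
  have hpos := Real.sqrt_pos.2 (one_sub_sq_mul_sin_sq_pos hk (jacobiAm k x))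
  have h := HasDerivAt.of_local_left_inverse (continuous_jacobiAm hk).continuousAt
    (hasDerivAt_ellipticF hk (jacobiAm k x)) (one_div_pos.2 hpos).ne'
    (Filter.Eventually.of_forall (ellipticF_jacobiAm hk))
  rwa [one_div, inv_inv] at h

theorem snR_sq_add_cnR_sq (k x : ℝ) : snR k x ^ 2 + cnR k x ^ 2 = 1 :=
  Real.sin_sq_add_cos_sq _

theorem dnR_sq {k : ℝ} (hk : k ∈ Set.Ioo (0 : ℝ) 1) (x : ℝ) :
    dnR k x ^ 2 = 1 - k ^ 2 * snR k x ^ 2 :=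
  Real.sq_sqrt (one_sub_sq_mul_sin_sq_pos hk _).le

theorem dnR_pos {k : ℝ} (hk : k ∈ Set.Ioo (0 : ℝ) 1) (x : ℝ) : 0 < dnR k x :=
  Real.sqrt_pos.2 (one_sub_sq_mul_sin_sq_pos hk _)

theorem hasDerivAt_snR {k : ℝ} (hk : k ∈ Set.Ioo (0 : ℝ) 1) (x : ℝ) :
    HasDerivAt (snR k) (cnR k x * dnR k x) x :=
  (hasDerivAt_jacobiAm hk x).sin

theorem hasDerivAt_cnR {k : ℝ} (hk : k ∈ Set.Ioo (0 : ℝ) 1) (x : ℝ) :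
    HasDerivAt (cnR k) (-(snR k x * dnR k x)) x := by
  rw [← neg_mul]
  exact (hasDerivAt_jacobiAm hk x).cos

theorem hasDerivAt_dnR {k : ℝ} (hk : k ∈ Set.Ioo (0 : ℝ) 1) (x : ℝ) :
    HasDerivAt (dnR k) (-(k ^ 2 * snR k x * cnR k x)) x := by
  have h := ((((hasDerivAt_snR hk x).fun_pow 2).const_mul (k ^ 2)).const_sub 1).sqrt
    (one_sub_sq_mul_sin_sq_pos hk _).ne'
  refine h.congr_deriv ?_
  change _ / (2 * dnR k x) = _
  have := (dnR_pos hk x).ne'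
  field_simp
  simp only [Nat.cast_ofNat, Nat.add_one_sub_one, pow_one]
  ring

theorem contDiff_jacobiAm {k : ℝ} (hk : k ∈ Set.Ioo (0 : ℝ) 1) : ContDiff ℝ ∞ (jacobiAm k) := by
  -- The amplitude satisfies `y' = √(1 - k ^ 2 * sin y ^ 2)`, which improves its regularity.
  have h : ∀ n : ℕ, ContDiff ℝ n (jacobiAm k) := by
    intro n
    induction n with
    | zero => exact contDiff_zero.2 (continuous_jacobiAm hk)
    | succ n ih =>
      push_cast
      refine contDiff_succ_iff_deriv.2
        ⟨fun x => (hasDerivAt_jacobiAm hk x).differentiableAt, by simp, ?_⟩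
      rw [funext fun x => (hasDerivAt_jacobiAm hk x).deriv]
      exact ContDiff.sqrt (contDiff_const.sub (contDiff_const.mul (ih.sin.pow 2)))
        fun x => (one_sub_sq_mul_sin_sq_pos hk _).ne'
  exact contDiff_infty.2 h

theorem contDiff_snR {k : ℝ} (hk : k ∈ Set.Ioo (0 : ℝ) 1) : ContDiff ℝ ∞ (snR k) :=
  (contDiff_jacobiAm hk).sin

theorem contDiff_cnR {k : ℝ} (hk : k ∈ Set.Ioo (0 : ℝ) 1) : ContDiff ℝ ∞ (cnR k) :=
  (contDiff_jacobiAm hk).cos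

theorem contDiff_dnR {k : ℝ} (hk : k ∈ Set.Ioo (0 : ℝ) 1) : ContDiff ℝ ∞ (dnR k) :=
  ContDiff.sqrt (contDiff_const.sub (contDiff_const.mul ((contDiff_snR hk).pow 2)))
    fun _ => (one_sub_sq_mul_sin_sq_pos hk _).ne'

theorem exists_snR_cnR_eq {k : ℝ} (hk : k ∈ Set.Ioo (0 : ℝ) 1) {s c : ℝ}
    (h : s ^ 2 + c ^ 2 = 1) : ∃ x, snR k x = s ∧ cnR k x = c := by
  have hn : ‖(⟨c, s⟩ : ℂ)‖ = 1 := by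
    rw [← sq_eq_sq₀ (norm_nonneg _) zero_le_one, Complex.sq_norm, Complex.normSq_mk]
    linarith
  have h0 : (⟨c, s⟩ : ℂ) ≠ 0 := norm_ne_zero_iff.1 (by rw [hn]; exact one_ne_zero)
  refine ⟨ellipticF k (Complex.arg ⟨c, s⟩), ?_, ?_⟩
  · rw [snR, jacobiAm_ellipticF hk, Complex.sin_arg, hn, div_one]
  · rw [cnR, jacobiAm_ellipticF hk, Complex.cos_arg h0, hn, div_one]

/-! ### Derivatives in the coordinates `u` and `v` -/

/-- The linear map of the plane into space that sends `1` to `V` and `I` to `W`. -/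
noncomputable def coordMap (V W : E3) : ℂ →L[ℝ] E3 :=
  Complex.reCLM.smulRight V + Complex.imCLM.smulRight W

/-- The linear form on the plane with value `x` at `1` and value `y` at `I`. -/
noncomputable def coordForm (x y : ℝ) : ℂ →L[ℝ] ℝ := x • Complex.reCLM + y • Complex.imCLM

@[simp] theorem coordMap_apply (V W : E3) (h : ℂ) : coordMap V W h = h.re • V + h.im • W := rfl

@[simp] theorem coordForm_apply (x y : ℝ) (h : ℂ) : coordForm x y h = x * h.re + y * h.im := rfl

theorem hasFDerivAt_coordMap {F : ℂ → E3} {V W : E3} {z : ℂ}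
    (h : ∀ i, HasFDerivAt (fun w => F w i) (coordForm (V i) (W i)) z) :
    HasFDerivAt F (coordMap V W) z := by
  rw [← hasFDerivWithinAt_univ]
  refine hasFDerivWithinAt_euclidean.2 fun i => ((h i).congr_fderiv ?_).hasFDerivWithinAt
  ext h
  simp [mul_comm]

theorem HasDerivAt.hasFDerivAt_re {f : ℝ → ℝ} {f' : ℝ} {z : ℂ} (hf : HasDerivAt f f' z.re) :
    HasFDerivAt (fun w : ℂ => f w.re) (coordForm f' 0) z := by
  refine (hf.comp_hasFDerivAt z Complex.reCLM.hasFDerivAt).congr_fderiv ?_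
  ext h
  simp

theorem HasDerivAt.hasFDerivAt_im {f : ℝ → ℝ} {f' : ℝ} {z : ℂ} (hf : HasDerivAt f f' z.im) :
    HasFDerivAt (fun w : ℂ => f w.im) (coordForm 0 f') z := by
  refine (hf.comp_hasFDerivAt z Complex.imCLM.hasFDerivAt).congr_fderiv ?_
  ext h
  simp

theorem hasFDerivAt_const_mul_re_mul_im {f g : ℝ → ℝ} {f' g' : ℝ} {z : ℂ} (κ : ℝ)
    (hf : HasDerivAt f f' z.re) (hg : HasDerivAt g g' z.im) :
    HasFDerivAt (fun w : ℂ => κ * (f w.re * g w.im))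
      (coordForm (κ * (f' * g z.im)) (κ * (f z.re * g'))) z := by
  refine ((hf.hasFDerivAt_re.mul hg.hasFDerivAt_im).const_mul κ).congr_fderiv ?_
  ext h
  simp
  ring

theorem norm_sq_coordMap {V W : E3} (hVW : inner ℝ V W = 0) (h : ℂ) :
    ‖coordMap V W h‖ ^ 2 = h.re ^ 2 * ‖V‖ ^ 2 + h.im ^ 2 * ‖W‖ ^ 2 := by
  rw [coordMap_apply, norm_add_sq_real, inner_smul_left, inner_smul_right, hVW, norm_smul,
    norm_smul, mul_pow, mul_pow, Real.norm_eq_abs, Real.norm_eq_abs, sq_abs, sq_abs]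
  simp

theorem coordMap_injective {V W : E3} (hVW : inner ℝ V W = 0) (hV : V ≠ 0) (hW : W ≠ 0) :
    Function.Injective (coordMap V W) := by
  refine (injective_iff_map_eq_zero _).2 fun h h0 => ?_
  have h1 := norm_sq_coordMap hVW h
  rw [h0, norm_zero] at h1
  have hV' := pow_pos (norm_pos_iff.2 hV) 2
  have hW' := pow_pos (norm_pos_iff.2 hW) 2
  have h2 := mul_nonneg (sq_nonneg h.re) hV'.le
  have h3 := mul_nonneg (sq_nonneg h.im) hW'.le
  have h4 : h.re ^ 2 * ‖V‖ ^ 2 = 0 := by linarith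
  have h5 : h.im ^ 2 * ‖W‖ ^ 2 = 0 := by linarith
  apply Complex.ext
  · simpa [hV'.ne', hV] using h4
  · simpa [hW'.ne', hW] using h5

theorem real_inner_E3 (x y : E3) : inner ℝ x y = x 0 * y 0 + x 1 * y 1 + x 2 * y 2 := by
  simp [PiLp.inner_apply, Fin.sum_univ_three, mul_comm]

/-! ### The parametrization of the ellipsoid -/

/-- The factor `p² cn² u + q² cn² v`, which is the conformal factor of the parametrization when
the ellipsoid is the unit sphere. -/
noncomputable def confFactor (p q : ℝ) (z : ℂ) : ℝ :=
  p ^ 2 * cnR p z.re ^ 2 + q ^ 2 * cnR q z.im ^ 2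

/-- The derivative of `ellipsoidParam` with respect to `u`. -/
noncomputable def ellipsoidParamU (p q a b c : ℝ) (z : ℂ) : E3 :=
  !₂[a * (cnR p z.re * dnR p z.re * dnR q z.im), b * (snR p z.re * dnR p z.re * cnR q z.im),
    c * (p ^ 2 * snR p z.re * cnR p z.re * snR q z.im)]

/-- The derivative of `ellipsoidParam` with respect to `v`. -/
noncomputable def ellipsoidParamV (p q a b c : ℝ) (z : ℂ) : E3 :=
  !₂[-a * (snR p z.re * (q ^ 2 * snR q z.im * cnR q z.im)),
    b * (cnR p z.re * (snR q z.im * dnR q z.im)),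
    -c * (dnR p z.re * (cnR q z.im * dnR q z.im))]

theorem confFactor_pos {p q : ℝ} (hp : p ∈ Set.Ioo (0 : ℝ) 1) (hq : q ∈ Set.Ioo (0 : ℝ) 1)
    {z : ℂ} (hz : z ∈ regularDomain p q) : 0 < confFactor p q z := by
  have hp0 := hp.1
  have hq0 := hq.1
  unfold confFactor
  rcases hz with h | h <;> positivity

theorem isOpen_regularDomain {p q : ℝ} (hp : p ∈ Set.Ioo (0 : ℝ) 1)
    (hq : q ∈ Set.Ioo (0 : ℝ) 1) : IsOpen (regularDomain p q) :=
  (isOpen_ne_fun ((contDiff_cnR hp).continuous.comp Complex.continuous_re) continuous_const).union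
    (isOpen_ne_fun ((contDiff_cnR hq).continuous.comp Complex.continuous_im) continuous_const)

theorem contDiff_confFactor {p q : ℝ} (hp : p ∈ Set.Ioo (0 : ℝ) 1)
    (hq : q ∈ Set.Ioo (0 : ℝ) 1) : ContDiff ℝ ∞ (confFactor p q) :=
  (contDiff_const.mul (((contDiff_cnR hp).comp Complex.reCLM.contDiff).pow 2)).add
    (contDiff_const.mul (((contDiff_cnR hq).comp Complex.imCLM.contDiff).pow 2))

theorem hasFDerivAt_confFactor {p q : ℝ} (hp : p ∈ Set.Ioo (0 : ℝ) 1)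
    (hq : q ∈ Set.Ioo (0 : ℝ) 1) (z : ℂ) :
    HasFDerivAt (confFactor p q) (coordForm (-2 * p ^ 2 * (snR p z.re * cnR p z.re * dnR p z.re))
      (-2 * q ^ 2 * (snR q z.im * cnR q z.im * dnR q z.im))) z := by
  refine ((((hasDerivAt_cnR hp z.re).fun_pow 2).const_mul (p ^ 2)).hasFDerivAt_re.add
    ((((hasDerivAt_cnR hq z.im).fun_pow 2).const_mul (q ^ 2)).hasFDerivAt_im)).congr_fderiv ?_
  ext h
  simp
  ring

theorem hasFDerivAt_ellipsoidParam {p q : ℝ} (hp : p ∈ Set.Ioo (0 : ℝ) 1)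
    (hq : q ∈ Set.Ioo (0 : ℝ) 1) (a b c : ℝ) (z : ℂ) :
    HasFDerivAt (ellipsoidParam p q a b c)
      (coordMap (ellipsoidParamU p q a b c z) (ellipsoidParamV p q a b c z)) z := by
  refine hasFDerivAt_coordMap fun i => ?_
  fin_cases i
  · refine (hasFDerivAt_const_mul_re_mul_im a (hasDerivAt_snR hp z.re)
      (hasDerivAt_dnR hq z.im)).congr_fderiv ?_
    ext h
    simp [ellipsoidParamU, ellipsoidParamV]
  · refine (hasFDerivAt_const_mul_re_mul_im (-b) (hasDerivAt_cnR hp z.re)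
      (hasDerivAt_cnR hq z.im)).congr_fderiv ?_
    ext h
    simp [ellipsoidParamU, ellipsoidParamV]
  · refine (hasFDerivAt_const_mul_re_mul_im (-c) (hasDerivAt_dnR hp z.re)
      (hasDerivAt_snR hq z.im)).congr_fderiv ?_
    ext h
    simp [ellipsoidParamU, ellipsoidParamV]

theorem contDiff_E3_mk {f g h : ℂ → ℝ} (hf : ContDiff ℝ ∞ f) (hg : ContDiff ℝ ∞ g)
    (hh : ContDiff ℝ ∞ h) : ContDiff ℝ ∞ (fun z => (!₂[f z, g z, h z] : E3)) := by
  refine contDiff_euclidean.2 fun i => ?_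
  fin_cases i
  exacts [hf, hg, hh]

theorem contDiff_ellipsoidParam {p q : ℝ} (hp : p ∈ Set.Ioo (0 : ℝ) 1)
    (hq : q ∈ Set.Ioo (0 : ℝ) 1) (a b c : ℝ) : ContDiff ℝ ∞ (ellipsoidParam p q a b c) := by
  have hs := (contDiff_snR hp).comp Complex.reCLM.contDiff
  have hc := (contDiff_cnR hp).comp Complex.reCLM.contDiff
  have hd := (contDiff_dnR hp).comp Complex.reCLM.contDiff
  have hS := (contDiff_snR hq).comp Complex.imCLM.contDiff
  have hC := (contDiff_cnR hq).comp Complex.imCLM.contDiff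
  have hD := (contDiff_dnR hq).comp Complex.imCLM.contDiff
  exact contDiff_E3_mk (contDiff_const.mul (hs.mul hD)) (contDiff_const.mul (hc.mul hC))
    (contDiff_const.mul (hd.mul hS))

theorem contDiff_ellipsoidParamU {p q : ℝ} (hp : p ∈ Set.Ioo (0 : ℝ) 1)
    (hq : q ∈ Set.Ioo (0 : ℝ) 1) (a b c : ℝ) : ContDiff ℝ ∞ (ellipsoidParamU p q a b c) := by
  have hs := (contDiff_snR hp).comp Complex.reCLM.contDiff
  have hc := (contDiff_cnR hp).comp Complex.reCLM.contDiff
  have hd := (contDiff_dnR hp).comp Complex.reCLM.contDiff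
  have hS := (contDiff_snR hq).comp Complex.imCLM.contDiff
  have hC := (contDiff_cnR hq).comp Complex.imCLM.contDiff
  have hD := (contDiff_dnR hq).comp Complex.imCLM.contDiff
  exact contDiff_E3_mk (contDiff_const.mul ((hc.mul hd).mul hD))
    (contDiff_const.mul ((hs.mul hd).mul hC))
    (contDiff_const.mul (((contDiff_const.mul hs).mul hc).mul hS))

theorem contDiff_ellipsoidParamV {p q : ℝ} (hp : p ∈ Set.Ioo (0 : ℝ) 1)
    (hq : q ∈ Set.Ioo (0 : ℝ) 1) (a b c : ℝ) : ContDiff ℝ ∞ (ellipsoidParamV p q a b c) := by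
  have hs := (contDiff_snR hp).comp Complex.reCLM.contDiff
  have hc := (contDiff_cnR hp).comp Complex.reCLM.contDiff
  have hd := (contDiff_dnR hp).comp Complex.reCLM.contDiff
  have hS := (contDiff_snR hq).comp Complex.imCLM.contDiff
  have hC := (contDiff_cnR hq).comp Complex.imCLM.contDiff
  have hD := (contDiff_dnR hq).comp Complex.imCLM.contDiff
  exact contDiff_E3_mk (contDiff_const.mul (hs.mul ((contDiff_const.mul hS).mul hC)))
    (contDiff_const.mul (hc.mul (hS.mul hD)))
    (contDiff_const.mul (hd.mul (hC.mul hD)))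

/-- The mixed second derivative of `ellipsoidParam` is tangential: the parameters are
conjugate. -/
theorem fderiv_ellipsoidParamV_one {p q : ℝ} (hp : p ∈ Set.Ioo (0 : ℝ) 1)
    (hq : q ∈ Set.Ioo (0 : ℝ) 1) (hpq : p ^ 2 + q ^ 2 = 1) (a b c : ℝ) {z : ℂ}
    (hz : z ∈ regularDomain p q) :
    fderiv ℝ (ellipsoidParamV p q a b c) z 1 =
      (-(q ^ 2 * (snR q z.im * cnR q z.im * dnR q z.im)) / confFactor p q z) •
        ellipsoidParamU p q a b c z +
      (-(p ^ 2 * (snR p z.re * cnR p z.re * dnR p z.re)) / confFactor p q z) •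
        ellipsoidParamV p q a b c z := by
  have hS := hasDerivAt_snR hq z.im
  have hC := hasDerivAt_cnR hq z.im
  have hD := hasDerivAt_dnR hq z.im
  have h1 := hasFDerivAt_const_mul_re_mul_im (-a) (hasDerivAt_snR hp z.re)
    ((hS.const_mul (q ^ 2)).mul hC)
  have h2 := hasFDerivAt_const_mul_re_mul_im b (hasDerivAt_cnR hp z.re) (hS.mul hD)
  have h3 := hasFDerivAt_const_mul_re_mul_im (-c) (hasDerivAt_dnR hp z.re) (hC.mul hD)
  have hF : HasFDerivAt (ellipsoidParamV p q a b c) _ z :=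
    hasFDerivAt_coordMap (V := !₂[_, _, _]) (W := !₂[_, _, _]) fun i => by
      fin_cases i
      exacts [h1, h2, h3]
  rw [hF.fderiv]
  have hW := (confFactor_pos hp hq hz).ne'
  have e1 := snR_sq_add_cnR_sq p z.re
  have e2 := snR_sq_add_cnR_sq q z.im
  have e3 := dnR_sq hp z.re
  have e4 := dnR_sq hq z.im
  ext i
  fin_cases i <;> simp [ellipsoidParamU, ellipsoidParamV] <;> field_simp <;>
    unfold confFactor <;> grind

theorem inner_ellipsoidParamU_ellipsoidParamV {p q r a c : ℝ} (hpq : p ^ 2 + q ^ 2 = 1)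
    (ha : a ^ 2 = 1 + r ^ 2 * p ^ 2) (hc : c ^ 2 = 1 - r ^ 2 * q ^ 2) (z : ℂ) :
    inner ℝ (ellipsoidParamU p q a 1 c z) (ellipsoidParamV p q a 1 c z) = 0 := by
  rw [real_inner_E3]
  simp only [ellipsoidParamU, ellipsoidParamV, PiLp.toLp_apply, Matrix.cons_val]
  linear_combination (-(snR p z.re * cnR p z.re * dnR p z.re *
    (snR q z.im * cnR q z.im * dnR q z.im))) * (q ^ 2 * ha + p ^ 2 * hc + hpq)

theorem norm_sq_ellipsoidParamU {p q r a c : ℝ} (hp : p ∈ Set.Ioo (0 : ℝ) 1)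
    (hq : q ∈ Set.Ioo (0 : ℝ) 1) (hpq : p ^ 2 + q ^ 2 = 1) (ha : a ^ 2 = 1 + r ^ 2 * p ^ 2)
    (hc : c ^ 2 = 1 - r ^ 2 * q ^ 2) (z : ℂ) :
    ‖ellipsoidParamU p q a 1 c z‖ ^ 2 =
      confFactor p q z * (1 + r ^ 2 * p ^ 2 * cnR p z.re ^ 2) := by
  have e1 := snR_sq_add_cnR_sq p z.re
  have e2 := snR_sq_add_cnR_sq q z.im
  have e3 := dnR_sq hp z.re
  have e4 := dnR_sq hq z.im
  rw [← real_inner_self_eq_norm_sq, real_inner_E3]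
  simp only [ellipsoidParamU, PiLp.toLp_apply, Matrix.cons_val, confFactor]
  grind

theorem norm_sq_ellipsoidParamV {p q r a c : ℝ} (hp : p ∈ Set.Ioo (0 : ℝ) 1)
    (hq : q ∈ Set.Ioo (0 : ℝ) 1) (hpq : p ^ 2 + q ^ 2 = 1) (ha : a ^ 2 = 1 + r ^ 2 * p ^ 2)
    (hc : c ^ 2 = 1 - r ^ 2 * q ^ 2) (z : ℂ) :
    ‖ellipsoidParamV p q a 1 c z‖ ^ 2 =
      confFactor p q z * (1 - r ^ 2 * q ^ 2 * cnR q z.im ^ 2) := by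
  have e1 := snR_sq_add_cnR_sq p z.re
  have e2 := snR_sq_add_cnR_sq q z.im
  have e3 := dnR_sq hp z.re
  have e4 := dnR_sq hq z.im
  rw [← real_inner_self_eq_norm_sq, real_inner_E3]
  simp only [ellipsoidParamV, PiLp.toLp_apply, Matrix.cons_val, confFactor]
  grind

theorem ellipsoidParamU_ne_zero {p q r a c : ℝ} (hp : p ∈ Set.Ioo (0 : ℝ) 1)
    (hq : q ∈ Set.Ioo (0 : ℝ) 1) (hpq : p ^ 2 + q ^ 2 = 1) (ha : a ^ 2 = 1 + r ^ 2 * p ^ 2)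
    (hc : c ^ 2 = 1 - r ^ 2 * q ^ 2) {z : ℂ} (hz : z ∈ regularDomain p q) :
    ellipsoidParamU p q a 1 c z ≠ 0 := by
  intro h
  have h1 := norm_sq_ellipsoidParamU hp hq hpq ha hc z
  have h2 : 0 < confFactor p q z * (1 + r ^ 2 * p ^ 2 * cnR p z.re ^ 2) :=
    mul_pos (confFactor_pos hp hq hz) (by positivity)
  rw [← h1, h] at h2
  simp at h2

theorem ellipsoidParamV_ne_zero {p q r a c : ℝ} (hp : p ∈ Set.Ioo (0 : ℝ) 1)
    (hq : q ∈ Set.Ioo (0 : ℝ) 1) (hpq : p ^ 2 + q ^ 2 = 1) (hrq : r ^ 2 * q ^ 2 < 1)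
    (ha : a ^ 2 = 1 + r ^ 2 * p ^ 2) (hc : c ^ 2 = 1 - r ^ 2 * q ^ 2) {z : ℂ}
    (hz : z ∈ regularDomain p q) : ellipsoidParamV p q a 1 c z ≠ 0 := by
  intro h
  have h1 := norm_sq_ellipsoidParamV hp hq hpq ha hc z
  have h3 : cnR q z.im ^ 2 ≤ 1 := Real.cos_sq_le_one _
  have h2 : 0 < confFactor p q z * (1 - r ^ 2 * q ^ 2 * cnR q z.im ^ 2) :=
    mul_pos (confFactor_pos hp hq hz)
      (by nlinarith [mul_nonneg (sq_nonneg r) (sq_nonneg q), sq_nonneg (cnR q z.im)])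
  rw [← h1, h] at h2
  simp at h2

theorem isCurvatureLineParam_ellipsoidParam {p q r a c : ℝ} (hp : p ∈ Set.Ioo (0 : ℝ) 1)
    (hq : q ∈ Set.Ioo (0 : ℝ) 1) (hpq : p ^ 2 + q ^ 2 = 1) (hrq : r ^ 2 * q ^ 2 < 1)
    (ha : a ^ 2 = 1 + r ^ 2 * p ^ 2) (hc : c ^ 2 = 1 - r ^ 2 * q ^ 2) :
    IsCurvatureLineParam (ellipsoidParam p q a 1 c) (regularDomain p q) := by
  have hU : partialU (ellipsoidParam p q a 1 c) = ellipsoidParamU p q a 1 c := by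
    funext z
    simp [partialU, (hasFDerivAt_ellipsoidParam hp hq a 1 c z).fderiv]
  have hV : partialV (ellipsoidParam p q a 1 c) = ellipsoidParamV p q a 1 c := by
    funext z
    simp [partialV, (hasFDerivAt_ellipsoidParam hp hq a 1 c z).fderiv]
  refine ⟨(contDiff_ellipsoidParam hp hq a 1 c).contDiffOn, fun z hz => ⟨?_, ?_, ?_⟩⟩
  · rw [(hasFDerivAt_ellipsoidParam hp hq a 1 c z).fderiv]
    exact coordMap_injective (inner_ellipsoidParamU_ellipsoidParamV hpq ha hc z)
      (ellipsoidParamU_ne_zero hp hq hpq ha hc hz)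
      (ellipsoidParamV_ne_zero hp hq hpq hrq ha hc hz)
  · rw [hU, hV]
    exact inner_ellipsoidParamU_ellipsoidParamV hpq ha hc z
  · rw [hU, hV]
    exact Submodule.mem_span_pair.2
      ⟨_, _, (fderiv_ellipsoidParamV_one hp hq hpq a 1 c hz).symm⟩

/-- Elliptic coordinates on the unit sphere: a point with squared coordinates `x`, `y`, `w` has
the form `x = α (1 - q² β)`, `y = (1 - α) (1 - β)`, `w = β (1 - p² α)` with `α, β ∈ [0, 1]`. -/
theorem exists_elliptic_coordinates {p q x y w : ℝ} (hp : p ∈ Set.Ioo (0 : ℝ) 1)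
    (hpq : p ^ 2 + q ^ 2 = 1) (hx : 0 ≤ x) (hy : 0 ≤ y) (hw : 0 ≤ w) (h : x + y + w = 1) :
    ∃ α β : ℝ, 0 ≤ α ∧ α ≤ 1 ∧ 0 ≤ β ∧ β ≤ 1 ∧ α * (1 - q ^ 2 * β) = x ∧
      (1 - α) * (1 - β) = y ∧ β * (1 - p ^ 2 * α) = w := by
  have hp2 : p ^ 2 < 1 := by nlinarith [hp.1, hp.2]
  have hp0 : 0 < p ^ 2 := pow_pos hp.1 2
  -- `w = β (1 - p² α)` determines `β` from `α`; the condition `β ≤ 1` restricts `α` to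
  -- `[0, α₁]`, and `α` is found there with the intermediate value theorem.
  set α₁ := min 1 ((1 - w) / p ^ 2) with hα₁
  have hα0 : 0 ≤ α₁ := le_min zero_le_one (div_nonneg (by linarith) hp0.le)
  have hden : ∀ α ∈ Set.Icc 0 α₁, 0 < 1 - p ^ 2 * α ∧ w ≤ 1 - p ^ 2 * α := by
    intro α hα
    have h1 : α ≤ 1 := hα.2.trans (min_le_left _ _)
    have h2 : α ≤ (1 - w) / p ^ 2 := hα.2.trans (min_le_right _ _)
    rw [le_div_iff₀ hp0] at h2
    constructor <;> nlinarith
  have hcont : ContinuousOn (fun α : ℝ => α * (1 - q ^ 2 * (w / (1 - p ^ 2 * α))))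
      (Set.Icc 0 α₁) := by
    refine continuousOn_id.mul (continuousOn_const.sub (continuousOn_const.mul
      (continuousOn_const.div (by fun_prop) fun α hα => (hden α hα).1.ne')))
  have hmem : x ∈ Set.Icc ((0 : ℝ) * (1 - q ^ 2 * (w / (1 - p ^ 2 * 0))))
      (α₁ * (1 - q ^ 2 * (w / (1 - p ^ 2 * α₁)))) := by
    refine ⟨by simpa using hx, ?_⟩
    rcases le_total 1 ((1 - w) / p ^ 2) with h1 | h1
    · rw [hα₁, min_eq_left h1]
      have hq0 : 1 - p ^ 2 * 1 = q ^ 2 := by linarith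
      have hq1 : q ^ 2 ≠ 0 := by linarith
      rw [hq0, mul_div_cancel₀ _ hq1]
      linarith
    · have hα : p ^ 2 * α₁ = 1 - w := by
        rw [hα₁, min_eq_right h1, mul_div_cancel₀ _ hp0.ne']
      rw [div_le_one hp0] at h1
      have hw0 : w ≠ 0 := by linarith
      rw [hα, sub_sub_cancel, div_self hw0]
      nlinarith
  obtain ⟨α, hα, hαx⟩ := intermediate_value_Icc hα0 hcont hmem
  obtain ⟨hd, hwd⟩ := hden α hα
  have hβ : w / (1 - p ^ 2 * α) * (1 - p ^ 2 * α) = w := div_mul_cancel₀ _ hd.ne'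
  refine ⟨α, w / (1 - p ^ 2 * α), hα.1, hα.2.trans (min_le_left _ _), div_nonneg hw hd.le,
    (div_le_one hd).2 hwd, hαx, ?_, hβ⟩
  simp only at hαx
  linear_combination -hαx - hβ - h - α * (w / (1 - p ^ 2 * α)) * hpq

theorem mem_ellipsoid_ellipsoidParam {p q a b c : ℝ} (hp : p ∈ Set.Ioo (0 : ℝ) 1)
    (hq : q ∈ Set.Ioo (0 : ℝ) 1) (hpq : p ^ 2 + q ^ 2 = 1) (ha : a ≠ 0) (hb : b ≠ 0) (hc : c ≠ 0)
    (z : ℂ) : ellipsoidParam p q a b c z ∈ ellipsoid a b c := by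
  have e1 := snR_sq_add_cnR_sq p z.re
  have e2 := snR_sq_add_cnR_sq q z.im
  have e3 := dnR_sq hp z.re
  have e4 := dnR_sq hq z.im
  simp only [ellipsoid, ellipsoidParam, Set.mem_ofPred_eq, Matrix.cons_val, neg_mul, neg_div,
    neg_sq, mul_div_cancel_left₀ _ ha, mul_div_cancel_left₀ _ hb, mul_div_cancel_left₀ _ hc]
  grind

theorem image_ellipsoidParam {p q a b c : ℝ} (hp : p ∈ Set.Ioo (0 : ℝ) 1)
    (hq : q ∈ Set.Ioo (0 : ℝ) 1) (hpq : p ^ 2 + q ^ 2 = 1) (ha : a ≠ 0) (hb : b ≠ 0)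
    (hc : c ≠ 0) :
    ellipsoidParam p q a b c '' regularDomain p q =
      ellipsoid a b c \ {x | x 0 ^ 2 = (a * p) ^ 2 ∧ x 1 = 0 ∧ x 2 ^ 2 = (c * q) ^ 2} := by
  have hp0 := hp.1.ne'
  have hq0 := hq.1.ne'
  ext x
  constructor
  · rintro ⟨z, hz, rfl⟩
    refine ⟨mem_ellipsoid_ellipsoidParam hp hq hpq ha hb hc z, ?_⟩
    rintro ⟨h0, h1, h2⟩
    have e1 := snR_sq_add_cnR_sq p z.re
    have e2 := snR_sq_add_cnR_sq q z.im
    have e3 := dnR_sq hp z.re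
    have e4 := dnR_sq hq z.im
    have ha2 := pow_ne_zero 2 ha
    have hc2 := pow_ne_zero 2 hc
    simp only [ellipsoidParam, Matrix.cons_val, neg_mul, neg_sq, mul_pow,
      mul_right_inj' ha2, mul_right_inj' hc2, neg_eq_zero, mul_eq_zero, hb, false_or] at h0 h1 h2
    have hcc : cnR p z.re = 0 ∧ cnR q z.im = 0 := by
      rcases h1 with h1 | h1
      · refine ⟨h1, ?_⟩
        have : q ^ 2 * cnR q z.im ^ 2 = 0 := by rw [h1] at e1; grind
        simpa [hq0] using this
      · refine ⟨?_, h1⟩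
        have : p ^ 2 * cnR p z.re ^ 2 = 0 := by rw [h1] at e2; grind
        simpa [hp0] using this
    rcases hz with h | h
    exacts [h hcc.1, h hcc.2]
  · rintro ⟨hx, humb⟩
    obtain ⟨α, β, hα0, hα1, hβ0, hβ1, h0, h1, h2⟩ := exists_elliptic_coordinates hp hpq
      (sq_nonneg (x 0 / a)) (sq_nonneg (x 1 / b)) (sq_nonneg (x 2 / c)) hx
    have hp2 : p ^ 2 < 1 := by nlinarith [hp.1, hp.2]
    have hq2 : q ^ 2 < 1 := by nlinarith [hq.1, hq.2]
    have hD : 0 < 1 - q ^ 2 * β := by nlinarith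
    have hd : 0 < 1 - p ^ 2 * α := by nlinarith
    have hs : (x 0 / a / √(1 - q ^ 2 * β)) ^ 2 = α := by
      rw [div_pow, Real.sq_sqrt hD.le, ← h0, mul_div_cancel_right₀ _ hD.ne']
    have hS : (-(x 2 / c / √(1 - p ^ 2 * α))) ^ 2 = β := by
      rw [neg_sq, div_pow, Real.sq_sqrt hd.le, ← h2, mul_div_cancel_right₀ _ hd.ne']
    -- The sign of `x 1` is given to `cn u`, and `cn v` is nonnegative.
    obtain ⟨c₁, hc₁, hc₁C⟩ : ∃ c₁ : ℝ, c₁ ^ 2 = 1 - α ∧ -b * (c₁ * √(1 - β)) = x 1 := by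
      have habs : √(1 - α) * √(1 - β) = |x 1 / b| := by
        rw [← Real.sqrt_mul (by linarith), h1, Real.sqrt_sq_eq_abs]
      rcases le_total 0 (x 1 / b) with hs | hs
      · refine ⟨-√(1 - α), by rw [neg_sq, Real.sq_sqrt (by linarith)], ?_⟩
        rw [neg_mul √(1 - α), neg_mul_neg, habs, abs_of_nonneg hs, mul_div_cancel₀ _ hb]
      · refine ⟨√(1 - α), by rw [Real.sq_sqrt (by linarith)], ?_⟩
        rw [habs, abs_of_nonpos hs, neg_mul_neg, mul_div_cancel₀ _ hb]
    obtain ⟨u, hu, hu'⟩ := exists_snR_cnR_eq hp (s := x 0 / a / √(1 - q ^ 2 * β)) (c := c₁)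
      (by rw [hs, hc₁]; ring)
    obtain ⟨v, hv, hv'⟩ := exists_snR_cnR_eq hq (s := -(x 2 / c / √(1 - p ^ 2 * α)))
      (c := √(1 - β)) (by rw [hS, Real.sq_sqrt (by linarith)]; ring)
    have hdu : dnR p u = √(1 - p ^ 2 * α) := by rw [dnR, hu, hs]
    have hdv : dnR q v = √(1 - q ^ 2 * β) := by rw [dnR, hv, hS]
    have hDs := (Real.sqrt_pos.2 hD).ne'
    have hds := (Real.sqrt_pos.2 hd).ne'
    refine ⟨⟨u, v⟩, ?_, ?_⟩
    · by_contra hn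
      simp only [regularDomain, Set.mem_ofPred_eq, not_or, not_not, hu', hv'] at hn
      have hα : α = 1 := by rw [hn.1] at hc₁; linarith
      have hβ : β = 1 := by
        have := Real.sqrt_eq_zero'.1 hn.2
        linarith
      refine humb ⟨?_, ?_, ?_⟩
      · rw [hα, hβ, div_pow, eq_div_iff (pow_ne_zero 2 ha)] at h0
        linear_combination -h0 - a ^ 2 * hpq
      · rw [← hc₁C, hn.1]
        ring
      · rw [hα, hβ, div_pow, eq_div_iff (pow_ne_zero 2 hc)] at h2
        linear_combination -h2 - c ^ 2 * hpq
    · ext i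
      fin_cases i
      · simp only [ellipsoidParam, hu, hdv]
        simp [field]
      · simpa [ellipsoidParam, hu', hv'] using hc₁C
      · simp only [ellipsoidParam, hv, hdu]
        simp [field]

/-! ### Closed form of the branches -/

/-- The complex number `p cn u + i q cn v`; its argument is, up to scale, the second component of
the dual surface. -/
noncomputable def cnVector (p q : ℝ) (z : ℂ) : ℂ := ⟨p * cnR p z.re, q * cnR q z.im⟩

/-- The function `(2 / p) artanh (p sn u / dn v)`. -/
noncomputable def dualFst (p q : ℝ) (z : ℂ) : ℝ :=
  1 / p * (Real.log (dnR q z.im + p * snR p z.re) - Real.log (dnR q z.im - p * snR p z.re))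

/-- The function `(2 / q) artanh (q sn v / dn u)`. -/
noncomputable def dualThd (p q : ℝ) (z : ℂ) : ℝ :=
  1 / q * (Real.log (dnR p z.re + q * snR q z.im) - Real.log (dnR p z.re - q * snR q z.im))

/-- `y` is one of the values at `z` of the multi-valued dual surface, in a closed form without
exceptional points. -/
def IsDualValue (p q a b c : ℝ) (z : ℂ) (y : E3) : Prop :=
  y 0 = a * dualFst p q z ∧ y 2 = c * dualThd p q z ∧
    Complex.exp ((p * q / b * y 1 : ℝ) * Complex.I) * (confFactor p q z : ℝ) = cnVector p q z ^ 2

theorem normSq_cnVector (p q : ℝ) (z : ℂ) : Complex.normSq (cnVector p q z) = confFactor p q z := by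
  rw [cnVector, Complex.normSq_mk, confFactor]
  ring

theorem confFactor_eq_dnR_im {p q : ℝ} (hq : q ∈ Set.Ioo (0 : ℝ) 1) (hpq : p ^ 2 + q ^ 2 = 1)
    (z : ℂ) : confFactor p q z = dnR q z.im ^ 2 - (p * snR p z.re) ^ 2 := by
  rw [dnR_sq hq, confFactor]
  linear_combination p ^ 2 * snR_sq_add_cnR_sq p z.re + q ^ 2 * snR_sq_add_cnR_sq q z.im + hpq

theorem confFactor_eq_dnR_re {p q : ℝ} (hp : p ∈ Set.Ioo (0 : ℝ) 1) (hpq : p ^ 2 + q ^ 2 = 1)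
    (z : ℂ) : confFactor p q z = dnR p z.re ^ 2 - (q * snR q z.im) ^ 2 := by
  rw [dnR_sq hp, confFactor]
  linear_combination p ^ 2 * snR_sq_add_cnR_sq p z.re + q ^ 2 * snR_sq_add_cnR_sq q z.im + hpq

theorem abs_mul_snR_re_lt {p q : ℝ} (hp : p ∈ Set.Ioo (0 : ℝ) 1) (hq : q ∈ Set.Ioo (0 : ℝ) 1)
    (hpq : p ^ 2 + q ^ 2 = 1) {z : ℂ} (hz : z ∈ regularDomain p q) :
    |p * snR p z.re| < dnR q z.im := by
  refine abs_lt_of_sq_lt_sq ?_ (dnR_pos hq _).le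
  have h := confFactor_pos hp hq hz
  rw [confFactor_eq_dnR_im hq hpq] at h
  linarith

theorem abs_mul_snR_im_lt {p q : ℝ} (hp : p ∈ Set.Ioo (0 : ℝ) 1) (hq : q ∈ Set.Ioo (0 : ℝ) 1)
    (hpq : p ^ 2 + q ^ 2 = 1) {z : ℂ} (hz : z ∈ regularDomain p q) :
    |q * snR q z.im| < dnR p z.re := by
  refine abs_lt_of_sq_lt_sq ?_ (dnR_pos hp _).le
  have h := confFactor_pos hp hq hz
  rw [confFactor_eq_dnR_re hp hpq] at h
  linarith

theorem jacobiSn_eq_mk (p q : ℝ) (z : ℂ) : jacobiSn p q z =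
    ⟨snR p z.re * dnR q z.im / jacobiDenom p q z,
      cnR p z.re * dnR p z.re * snR q z.im * cnR q z.im / jacobiDenom p q z⟩ := by
  apply Complex.ext <;> simp only [jacobiSn, Complex.div_ofReal_re, Complex.div_ofReal_im] <;> simp

theorem jacobiCn_eq_mk (p q : ℝ) (z : ℂ) : jacobiCn p q z =
    ⟨cnR p z.re * cnR q z.im / jacobiDenom p q z,
      -(snR p z.re * dnR p z.re * snR q z.im * dnR q z.im) / jacobiDenom p q z⟩ := by
  apply Complex.ext <;> simp only [jacobiCn, Complex.div_ofReal_re, Complex.div_ofReal_im] <;> simp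

theorem jacobiDenom_pos {p q : ℝ} {z : ℂ} (h : jacobiSn p q z ≠ 0) : 0 < jacobiDenom p q z := by
  refine lt_of_le_of_ne (by unfold jacobiDenom; positivity) fun h0 => h ?_
  rw [jacobiSn, ← h0]
  simp

/-- For `ε = ±1` the quotient of these values is the squared absolute value of
`(1 + ζ) / (1 - ζ)` with `ζ = 1 / (p sn z)`. -/
theorem normSq_add_mul_jacobiSn {p q : ℝ} (hp : p ∈ Set.Ioo (0 : ℝ) 1)
    (hq : q ∈ Set.Ioo (0 : ℝ) 1) (hpq : p ^ 2 + q ^ 2 = 1) {z : ℂ} (hN : 0 < jacobiDenom p q z)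
    {ε : ℝ} (hε : ε ^ 2 = 1) : Complex.normSq (p * jacobiSn p q z + ε) =
      (dnR q z.im + ε * (p * snR p z.re)) ^ 2 / jacobiDenom p q z := by
  have e1 := snR_sq_add_cnR_sq p z.re
  have e2 := snR_sq_add_cnR_sq q z.im
  have e3 := dnR_sq hp z.re
  have e4 := dnR_sq hq z.im
  have hN0 := hN.ne'
  rw [jacobiSn_eq_mk, Complex.normSq_apply]
  simp only [Complex.add_re, Complex.mul_re, Complex.ofReal_re, Complex.ofReal_im, zero_mul,
    sub_zero, Complex.add_im, Complex.mul_im, add_zero]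
  field_simp
  unfold jacobiDenom
  grind

/-- For `ε = ±1` the quotient of these values is the squared absolute value of
`(1 + ζ) / (1 - ζ)` with `ζ = (q / i) sn z / cn z`. -/
theorem normSq_jacobiCn_add_mul_jacobiSn {p q : ℝ} (hp : p ∈ Set.Ioo (0 : ℝ) 1)
    (hq : q ∈ Set.Ioo (0 : ℝ) 1) (hpq : p ^ 2 + q ^ 2 = 1) {z : ℂ} (hN : 0 < jacobiDenom p q z)
    {ε : ℝ} (hε : ε ^ 2 = 1) :
    Complex.normSq (jacobiCn p q z - ε * (q * Complex.I * jacobiSn p q z)) =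
      (dnR p z.re + ε * (q * snR q z.im)) ^ 2 / jacobiDenom p q z := by
  have e1 := snR_sq_add_cnR_sq p z.re
  have e2 := snR_sq_add_cnR_sq q z.im
  have e3 := dnR_sq hp z.re
  have e4 := dnR_sq hq z.im
  have hN0 := hN.ne'
  rw [jacobiSn_eq_mk, jacobiCn_eq_mk, Complex.normSq_apply]
  simp only [Complex.sub_re, Complex.sub_im, Complex.mul_re, Complex.mul_im, Complex.ofReal_re,
    Complex.ofReal_im, Complex.I_re, Complex.I_im, zero_mul, mul_zero, mul_one, sub_zero, add_zero,
    zero_add, zero_sub]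
  field_simp
  unfold jacobiDenom
  grind

/-- The quotient `(p cn z + q i) / (p cn z - q i)`, whose argument is twice the real part of
`arctan (q / (p cn z))`, is a positive multiple of `(p cn u + i q cn v)²`. -/
theorem mul_jacobiCn_mul_conj {p q : ℝ} (hp : p ∈ Set.Ioo (0 : ℝ) 1)
    (hq : q ∈ Set.Ioo (0 : ℝ) 1) (hpq : p ^ 2 + q ^ 2 = 1) {z : ℂ}
    (hN : 0 < jacobiDenom p q z) :
    (p * jacobiCn p q z + q * Complex.I) * (starRingEnd ℂ) (p * jacobiCn p q z - q * Complex.I) =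
      cnVector p q z ^ 2 / (jacobiDenom p q z : ℝ) := by
  have e1 := snR_sq_add_cnR_sq p z.re
  have e2 := snR_sq_add_cnR_sq q z.im
  have e3 := dnR_sq hp z.re
  have e4 := dnR_sq hq z.im
  have hN0 := hN.ne'
  rw [jacobiCn_eq_mk, sq, cnVector]
  apply Complex.ext
  · simp only [Complex.div_ofReal_re, Complex.mul_re, Complex.mul_im, Complex.add_re,
      Complex.add_im, Complex.sub_re, Complex.sub_im, Complex.conj_re, Complex.conj_im,
      Complex.ofReal_re, Complex.ofReal_im, Complex.I_re, Complex.I_im]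
    field_simp
    unfold jacobiDenom
    grind
  · simp only [Complex.div_ofReal_im, Complex.mul_re, Complex.mul_im, Complex.add_re,
      Complex.add_im, Complex.sub_re, Complex.sub_im, Complex.conj_re, Complex.conj_im,
      Complex.ofReal_re, Complex.ofReal_im, Complex.I_re, Complex.I_im]
    field_simp
    ring

theorem artanhC_re (ζ : ℂ) : (artanhC ζ).re = 1 / 2 * Real.log ‖(1 + ζ) / (1 - ζ)‖ := by
  have : artanhC ζ = ((1 / 2 : ℝ) : ℂ) * Complex.log ((1 + ζ) / (1 - ζ)) := by
    rw [artanhC]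
    norm_num
  rw [this, Complex.re_ofReal_mul, Complex.log_re]

theorem arctan_re (ζ : ℂ) :
    (Complex.arctan ζ).re = 1 / 2 * Complex.arg ((1 + ζ * Complex.I) / (1 - ζ * Complex.I)) := by
  rw [Complex.arctan, ← Complex.log_im]
  simp
  ring

theorem norm_div_eq_of_normSq {x y : ℂ} {s t N : ℝ} (hN : 0 < N) (hs : 0 < s) (ht : 0 < t)
    (hx : Complex.normSq x = s ^ 2 / N) (hy : Complex.normSq y = t ^ 2 / N) :
    ‖x / y‖ = s / t := by
  rw [← sq_eq_sq₀ (norm_nonneg _) (by positivity), Complex.sq_norm, Complex.normSq_div, hx, hy,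
    div_pow]
  field_simp

theorem dualFst_eq {p q : ℝ} (hp : p ∈ Set.Ioo (0 : ℝ) 1) (hq : q ∈ Set.Ioo (0 : ℝ) 1)
    (hpq : p ^ 2 + q ^ 2 = 1) {z : ℂ} (hz : z ∈ regularDomain p q) (hs : jacobiSn p q z ≠ 0)
    (a : ℝ) : (2 * a / p * artanhC (1 / (p * jacobiSn p q z))).re = a * dualFst p q z := by
  have hN := jacobiDenom_pos hs
  have hp0 : (p : ℂ) ≠ 0 := Complex.ofReal_ne_zero.2 hp.1.ne'
  have hlt := abs_lt.1 (abs_mul_snR_re_lt hp hq hpq hz)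
  have h1 := normSq_add_mul_jacobiSn hp hq hpq hN (ε := 1) (by norm_num)
  have h2 := normSq_add_mul_jacobiSn hp hq hpq hN (ε := -1) (by norm_num)
  rw [one_mul] at h1
  rw [neg_one_mul, ← sub_eq_add_neg] at h2
  have hq1 : (1 + 1 / (p * jacobiSn p q z)) / (1 - 1 / (p * jacobiSn p q z)) =
      (p * jacobiSn p q z + (1 : ℝ)) / (p * jacobiSn p q z + (-1 : ℝ)) := by
    have h0 := mul_ne_zero hp0 hs
    rw [one_add_div h0, one_sub_div h0, div_div_div_cancel_right₀ h0]
    push_cast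
    ring
  rw [show (2 * a / p : ℂ) = ((2 * a / p : ℝ) : ℂ) by push_cast; rfl, Complex.re_ofReal_mul,
    artanhC_re, hq1, norm_div_eq_of_normSq hN (by linarith) (by linarith) h1 h2,
    Real.log_div (by linarith) (by linarith), dualFst]
  ring

theorem dualThd_eq {p q : ℝ} (hp : p ∈ Set.Ioo (0 : ℝ) 1) (hq : q ∈ Set.Ioo (0 : ℝ) 1)
    (hpq : p ^ 2 + q ^ 2 = 1) {z : ℂ} (hz : z ∈ regularDomain p q) (hs : jacobiSn p q z ≠ 0)
    (hc : jacobiCn p q z ≠ 0) (c : ℝ) :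
    (2 * c / q * artanhC (q / Complex.I * (jacobiSn p q z / jacobiCn p q z))).re =
      c * dualThd p q z := by
  have hN := jacobiDenom_pos hs
  have hlt := abs_lt.1 (abs_mul_snR_im_lt hp hq hpq hz)
  have h1 := normSq_jacobiCn_add_mul_jacobiSn hp hq hpq hN (ε := 1) (by norm_num)
  have h2 := normSq_jacobiCn_add_mul_jacobiSn hp hq hpq hN (ε := -1) (by norm_num)
  rw [one_mul] at h1
  rw [neg_one_mul, ← sub_eq_add_neg] at h2
  have hq1 : (1 + q / Complex.I * (jacobiSn p q z / jacobiCn p q z)) /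
      (1 - q / Complex.I * (jacobiSn p q z / jacobiCn p q z)) =
      (jacobiCn p q z - (1 : ℝ) * (q * Complex.I * jacobiSn p q z)) /
        (jacobiCn p q z - (-1 : ℝ) * (q * Complex.I * jacobiSn p q z)) := by
    have h3 : q / Complex.I * (jacobiSn p q z / jacobiCn p q z) =
        -(q * Complex.I * jacobiSn p q z) / jacobiCn p q z := by
      rw [Complex.div_I]
      ring
    rw [h3, one_add_div hc, one_sub_div hc, div_div_div_cancel_right₀ hc]
    push_cast
    ring
  rw [show (2 * c / q : ℂ) = ((2 * c / q : ℝ) : ℂ) by push_cast; rfl, Complex.re_ofReal_mul,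
    artanhC_re, hq1, norm_div_eq_of_normSq hN (by linarith) (by linarith) h1 h2,
    Real.log_div (by linarith) (by linarith), dualThd]
  ring

/-- The values of `arctan (q / (p cn z))` have, up to multiples of `π`, the argument of
`p cn u + i q cn v` as their real part. -/
theorem exists_arctan_eq_iff {p q b : ℝ} (hp : p ∈ Set.Ioo (0 : ℝ) 1)
    (hq : q ∈ Set.Ioo (0 : ℝ) 1) (hpq : p ^ 2 + q ^ 2 = 1) (hb : b ≠ 0) {z : ℂ}
    (hz : z ∈ regularDomain p q) (hs : jacobiSn p q z ≠ 0) (hc : jacobiCn p q z ≠ 0) (t : ℝ) :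
    (∃ k : ℤ, t = (2 * b / (p * q) *
      (Complex.arctan (q / (p * jacobiCn p q z)) + k * Real.pi)).re) ↔
    Complex.exp ((p * q / b * t : ℝ) * Complex.I) * (confFactor p q z : ℝ) =
      cnVector p q z ^ 2 := by
  have hN := jacobiDenom_pos hs
  have hW := confFactor_pos hp hq hz
  have hp0 := hp.1.ne'
  have hq0 := hq.1.ne'
  have hpc : (p : ℂ) * jacobiCn p q z ≠ 0 := mul_ne_zero (Complex.ofReal_ne_zero.2 hp0) hc
  have hG : cnVector p q z ≠ 0 := by
    rw [← Complex.normSq_pos, normSq_cnVector]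
    exact hW
  set m := p * jacobiCn p q z + q * Complex.I with hm
  set n := p * jacobiCn p q z - q * Complex.I with hn
  have hmn : m * (starRingEnd ℂ) n = cnVector p q z ^ 2 / (jacobiDenom p q z : ℝ) :=
    mul_jacobiCn_mul_conj hp hq hpq hN
  have hn0 : n ≠ 0 := by
    rintro h0
    rw [h0, map_zero, mul_zero] at hmn
    exact div_ne_zero (pow_ne_zero 2 hG) (Complex.ofReal_ne_zero.2 hN.ne') hmn.symm
  have hQ : (1 + q / (p * jacobiCn p q z) * Complex.I) /
      (1 - q / (p * jacobiCn p q z) * Complex.I) =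
      ((jacobiDenom p q z * Complex.normSq n)⁻¹ : ℝ) * cnVector p q z ^ 2 := by
    rw [div_mul_eq_mul_div, one_add_div hpc, one_sub_div hpc, div_div_div_cancel_right₀ hpc,
      ← hm, ← hn, div_eq_mul_inv, Complex.inv_def, ← mul_assoc, hmn]
    push_cast
    have : (Complex.normSq n : ℂ) ≠ 0 := by simpa using hn0
    have : (jacobiDenom p q z : ℂ) ≠ 0 := by simpa using hN.ne'
    field_simp
  have harg : (Complex.arctan (q / (p * jacobiCn p q z))).re =
      1 / 2 * Complex.arg (cnVector p q z ^ 2) := by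
    rw [arctan_re, hQ, Complex.arg_real_mul]
    exact inv_pos.2 (mul_pos hN (Complex.normSq_pos.2 hn0))
  have hpolar : Complex.exp (Complex.arg (cnVector p q z ^ 2) * Complex.I) *
      (confFactor p q z : ℝ) = cnVector p q z ^ 2 := by
    have h := Complex.norm_mul_exp_arg_mul_I (cnVector p q z ^ 2)
    rw [norm_pow, Complex.sq_norm, normSq_cnVector] at h
    rw [mul_comm, h]
  have hre : ∀ k : ℤ, (2 * b / (p * q) *
      (Complex.arctan (q / (p * jacobiCn p q z)) + k * Real.pi) : ℂ).re =
      b / (p * q) * (Complex.arg (cnVector p q z ^ 2) + k * (2 * Real.pi)) := by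
    intro k
    rw [show (2 * b / (p * q) : ℂ) = ((2 * b / (p * q) : ℝ) : ℂ) by push_cast; rfl,
      Complex.re_ofReal_mul, Complex.add_re, harg,
      show (k * Real.pi : ℂ) = ((k * Real.pi : ℝ) : ℂ) by push_cast; rfl, Complex.ofReal_re]
    ring
  have hW0 : ((confFactor p q z : ℝ) : ℂ) ≠ 0 := Complex.ofReal_ne_zero.2 hW.ne'
  rw [← hpolar, mul_left_inj' hW0, Complex.exp_eq_exp_iff_exists_int]
  refine exists_congr fun k => ?_
  rw [hre]
  have h2 : (((p * q / b * t : ℝ) : ℂ) * Complex.I =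
      Complex.arg (cnVector p q z ^ 2) * Complex.I + k * (2 * Real.pi * Complex.I)) ↔
      p * q / b * t = Complex.arg (cnVector p q z ^ 2) + k * (2 * Real.pi) := by
    rw [show Complex.arg (cnVector p q z ^ 2) * Complex.I + k * (2 * Real.pi * Complex.I) =
      ((Complex.arg (cnVector p q z ^ 2) + k * (2 * Real.pi) : ℝ) : ℂ) * Complex.I by
        push_cast; ring, mul_left_inj' Complex.I_ne_zero, Complex.ofReal_inj]
  rw [h2]
  constructor <;> intro h
  · rw [h]
    field_simp
  · rw [← h]
    field_simp

theorem exists_dual_formula_iff {p q b : ℝ} (hp : p ∈ Set.Ioo (0 : ℝ) 1)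
    (hq : q ∈ Set.Ioo (0 : ℝ) 1) (hpq : p ^ 2 + q ^ 2 = 1) (a : ℝ) (hb : b ≠ 0) (c : ℝ) {z : ℂ}
    (hz : z ∈ regularDomain p q) (hs : jacobiSn p q z ≠ 0) (hc : jacobiCn p q z ≠ 0) (y : E3) :
    (∃ k : ℤ,
      y = !₂[(2 * a / p * artanhC (1 / (p * jacobiSn p q z))).re,
        (2 * b / (p * q) * (Complex.arctan (q / (p * jacobiCn p q z)) + k * Real.pi)).re,
        (2 * c / q * artanhC (q / Complex.I * (jacobiSn p q z / jacobiCn p q z))).re]) ↔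
      IsDualValue p q a b c z y := by
  rw [IsDualValue, ← exists_arctan_eq_iff hp hq hpq hb hz hs hc, ← dualFst_eq hp hq hpq hz hs,
    ← dualThd_eq hp hq hpq hz hs hc, ← exists_and_left, ← exists_and_left]
  refine exists_congr fun k => ?_
  constructor
  · intro h
    rw [h]
    exact ⟨rfl, rfl, rfl⟩
  · rintro ⟨h0, h2, h1⟩
    ext i
    fin_cases i
    exacts [h0, h1, h2]

theorem dense_snR_mul_cnR_ne_zero {k : ℝ} (hk : k ∈ Set.Ioo (0 : ℝ) 1) :
    Dense {x : ℝ | snR k x * cnR k x ≠ 0} := by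
  intro x
  by_contra hx
  have h : (fun y => snR k y * cnR k y) =ᶠ[nhds x] fun _ => 0 := by
    filter_upwards [isClosed_closure.isOpen_compl.mem_nhds hx] with y hy
    by_contra hy'
    exact hy (subset_closure hy')
  have h1 := ((hasDerivAt_snR hk x).mul (hasDerivAt_cnR hk x)).unique
    ((hasDerivAt_const x (0 : ℝ)).congr_of_eventuallyEq h)
  have h2 : snR k x * cnR k x = 0 := h.self_of_nhds
  have h3 := snR_sq_add_cnR_sq k x
  have h4 : dnR k x * (cnR k x ^ 2 - snR k x ^ 2) = 0 := by linarith
  have h5 := (mul_eq_zero.1 h4).resolve_left (dnR_pos hk x).ne'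
  rcases mul_eq_zero.1 h2 with h6 | h6 <;> rw [h6] at h3 h5 <;> linarith

theorem jacobiSn_ne_zero_and_jacobiCn_ne_zero {p q : ℝ} (hp : p ∈ Set.Ioo (0 : ℝ) 1)
    (hq : q ∈ Set.Ioo (0 : ℝ) 1) {z : ℂ} (h : snR p z.re * cnR p z.re ≠ 0) :
    jacobiSn p q z ≠ 0 ∧ jacobiCn p q z ≠ 0 := by
  have hp0 := hp.1
  obtain ⟨hs, hc⟩ := mul_ne_zero_iff.1 h
  have e2 := snR_sq_add_cnR_sq q z.im
  have hN : jacobiDenom p q z ≠ 0 := by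
    unfold jacobiDenom
    by_cases hC : cnR q z.im = 0
    · have hS : snR q z.im ≠ 0 := by rintro h0; simp [hC, h0] at e2
      positivity
    · positivity
  constructor
  · intro h0
    rw [jacobiSn_eq_mk, Complex.ext_iff] at h0
    simpa [hs, hN, (dnR_pos hq z.im).ne'] using h0.1
  · intro h0
    rw [jacobiCn_eq_mk, Complex.ext_iff] at h0
    have h1 : cnR q z.im = 0 := by simpa [hc, hN] using h0.1
    have h2 : snR q z.im = 0 := by
      simpa [hs, hN, (dnR_pos hq z.im).ne', (dnR_pos hp z.re).ne'] using h0.2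
    rw [h1, h2] at e2
    norm_num at e2

theorem continuous_cnVector {p q : ℝ} (hp : p ∈ Set.Ioo (0 : ℝ) 1) (hq : q ∈ Set.Ioo (0 : ℝ) 1) :
    Continuous (cnVector p q) := by
  have h1 : Continuous fun z : ℂ => p * cnR p z.re :=
    continuous_const.mul ((contDiff_cnR hp).continuous.comp Complex.continuous_re)
  have h2 : Continuous fun z : ℂ => q * cnR q z.im :=
    continuous_const.mul ((contDiff_cnR hq).continuous.comp Complex.continuous_im)
  exact Complex.equivRealProdCLM.symm.continuous.comp (h1.prodMk h2)

theorem hasFDerivAt_dualFst {p q : ℝ} (hp : p ∈ Set.Ioo (0 : ℝ) 1) (hq : q ∈ Set.Ioo (0 : ℝ) 1)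
    (hpq : p ^ 2 + q ^ 2 = 1) {z : ℂ} (hz : z ∈ regularDomain p q) :
    HasFDerivAt (dualFst p q)
      (coordForm (2 / confFactor p q z * (cnR p z.re * dnR p z.re * dnR q z.im))
        (2 / confFactor p q z * (snR p z.re * (q ^ 2 * snR q z.im * cnR q z.im)))) z := by
  have hlt := abs_lt.1 (abs_mul_snR_re_lt hp hq hpq hz)
  have h1 := ((hasDerivAt_snR hp z.re).const_mul p).hasFDerivAt_re
  have h2 := (hasDerivAt_dnR hq z.im).hasFDerivAt_im
  have hpos : 0 < dnR q z.im + p * snR p z.re := by linarith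
  have hneg : 0 < dnR q z.im - p * snR p z.re := by linarith
  have hp0 := hp.1.ne'
  refine ((((h2.fun_add h1).log hpos.ne').sub ((h2.fun_sub h1).log hneg.ne')).const_mul
    (1 / p)).congr_fderiv ?_
  ext h
  simp only [smul_apply, sub_apply,
    add_apply, coordForm_apply, smul_eq_mul, confFactor_eq_dnR_im hq hpq,
    sq_sub_sq]
  field_simp
  ring

theorem hasFDerivAt_dualThd {p q : ℝ} (hp : p ∈ Set.Ioo (0 : ℝ) 1) (hq : q ∈ Set.Ioo (0 : ℝ) 1)
    (hpq : p ^ 2 + q ^ 2 = 1) {z : ℂ} (hz : z ∈ regularDomain p q) :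
    HasFDerivAt (dualThd p q)
      (coordForm (2 / confFactor p q z * (p ^ 2 * snR p z.re * cnR p z.re * snR q z.im))
        (2 / confFactor p q z * (dnR p z.re * (cnR q z.im * dnR q z.im)))) z := by
  have hlt := abs_lt.1 (abs_mul_snR_im_lt hp hq hpq hz)
  have h1 := ((hasDerivAt_snR hq z.im).const_mul q).hasFDerivAt_im
  have h2 := (hasDerivAt_dnR hp z.re).hasFDerivAt_re
  have hpos : 0 < dnR p z.re + q * snR q z.im := by linarith
  have hneg : 0 < dnR p z.re - q * snR q z.im := by linarith
  have hq0 := hq.1.ne'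
  refine ((((h2.fun_add h1).log hpos.ne').sub ((h2.fun_sub h1).log hneg.ne')).const_mul
    (1 / q)).congr_fderiv ?_
  ext h
  simp only [smul_apply, sub_apply,
    add_apply, coordForm_apply, smul_eq_mul, confFactor_eq_dnR_re hp hpq,
    sq_sub_sq]
  field_simp
  ring

/-- A branch has values of the closed form at all points of its domain, since the points where
`sn` or `cn` has a zero or a pole are nowhere dense. -/
theorem isDualBranch_iff {p q b : ℝ} (hp : p ∈ Set.Ioo (0 : ℝ) 1)
    (hq : q ∈ Set.Ioo (0 : ℝ) 1) (hpq : p ^ 2 + q ^ 2 = 1) (a : ℝ) (hb : b ≠ 0) (c : ℝ)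
    (U : Set ℂ) (Y : ℂ → E3) :
    IsDualBranch p q a b c U Y ↔ IsOpen U ∧ U ⊆ regularDomain p q ∧ ContinuousOn Y U ∧
      ∀ z ∈ U, IsDualValue p q a b c z (Y z) := by
  refine and_congr_right fun hU => and_congr_right fun hUΩ => and_congr_right fun hY =>
    ⟨fun h => ?_, fun h z hz hs hc =>
      (exists_dual_formula_iff hp hq hpq a hb c (hUΩ hz) hs hc _).2 (h z hz)⟩
  have hdense : Dense {z : ℂ | snR p z.re * cnR p z.re ≠ 0} :=
    (dense_snR_mul_cnR_ne_zero hp).preimage Complex.isOpenMap_re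
  have hval : ∀ z ∈ U ∩ {z : ℂ | snR p z.re * cnR p z.re ≠ 0}, IsDualValue p q a b c z (Y z) := by
    intro z hz
    obtain ⟨hs, hc⟩ := jacobiSn_ne_zero_and_jacobiCn_ne_zero hp hq hz.2
    exact (exists_dual_formula_iff hp hq hpq a hb c (hUΩ hz.1) hs hc _).1 (h z hz.1 hs hc)
  have hsub := hdense.open_subset_closure_inter hU
  have hYi : ∀ i, ContinuousOn (fun z => Y z i) U := fun i =>
    (EuclideanSpace.proj (𝕜 := ℝ) i).continuous.comp_continuousOn hY
  have h0 : Set.EqOn (fun z => Y z 0) (fun z => a * dualFst p q z) U :=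
    Set.EqOn.of_subset_closure (fun z hz => (hval z hz).1) (hYi 0)
      (continuousOn_const.mul fun z hz =>
        (hasFDerivAt_dualFst hp hq hpq (hUΩ hz)).continuousAt.continuousWithinAt)
      Set.inter_subset_left hsub
  have h2 : Set.EqOn (fun z => Y z 2) (fun z => c * dualThd p q z) U :=
    Set.EqOn.of_subset_closure (fun z hz => (hval z hz).2.1) (hYi 2)
      (continuousOn_const.mul fun z hz =>
        (hasFDerivAt_dualThd hp hq hpq (hUΩ hz)).continuousAt.continuousWithinAt)
      Set.inter_subset_left hsub
  have h1 : Set.EqOn (fun z => Complex.exp ((p * q / b * Y z 1 : ℝ) * Complex.I) *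
      (confFactor p q z : ℝ)) (fun z => cnVector p q z ^ 2) U :=
    Set.EqOn.of_subset_closure (fun z hz => (hval z hz).2.2)
      (((Complex.continuous_exp.comp_continuousOn
        ((Complex.continuous_ofReal.comp_continuousOn (continuousOn_const.mul (hYi 1))).mul
          continuousOn_const)).mul (Complex.continuous_ofReal.comp
            (contDiff_confFactor hp hq).continuous).continuousOn))
      ((continuous_cnVector hp hq).pow 2).continuousOn Set.inter_subset_left hsub
  exact fun z hz => ⟨h0 hz, h2 hz, h1 hz⟩

/-! ### The branches are Christoffel duals -/

/-- The equation for the second component of the dual surface in real terms. -/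
theorem exp_mul_confFactor_eq_iff (p q : ℝ) (z : ℂ) (θ : ℝ) :
    Complex.exp (θ * Complex.I) * (confFactor p q z : ℝ) = cnVector p q z ^ 2 ↔
      confFactor p q z * Real.cos θ = p ^ 2 * cnR p z.re ^ 2 - q ^ 2 * cnR q z.im ^ 2 ∧
      confFactor p q z * Real.sin θ = 2 * p * q * (cnR p z.re * cnR q z.im) := by
  rw [Complex.ext_iff, Complex.re_mul_ofReal, Complex.im_mul_ofReal, Complex.exp_ofReal_mul_I_re,
    Complex.exp_ofReal_mul_I_im, sq, Complex.mul_re, Complex.mul_im, cnVector, mul_comm (Real.cos θ),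
    mul_comm (Real.sin θ)]
  refine and_congr (Eq.congr_right ?_) (Eq.congr_right ?_)
  · ring
  · ring

/-- A continuous choice `θ` of twice the argument of `p cn u + i q cn v` is differentiable. -/
theorem hasFDerivAt_of_cos_sin_eq {p q : ℝ} (hp : p ∈ Set.Ioo (0 : ℝ) 1)
    (hq : q ∈ Set.Ioo (0 : ℝ) 1) {θ : ℂ → ℝ} {z : ℂ} (hz : z ∈ regularDomain p q)
    (hθ : ContinuousAt θ z)
    (h : ∀ᶠ w in nhds z,
      confFactor p q w * Real.cos (θ w) = p ^ 2 * cnR p w.re ^ 2 - q ^ 2 * cnR q w.im ^ 2 ∧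
      confFactor p q w * Real.sin (θ w) = 2 * p * q * (cnR p w.re * cnR q w.im)) :
    HasFDerivAt θ (coordForm
      (2 * p * q / confFactor p q z * (snR p z.re * dnR p z.re * cnR q z.im))
      (-(2 * p * q / confFactor p q z * (cnR p z.re * (snR q z.im * dnR q z.im))))) z := by
  have hc := hasDerivAt_cnR hp z.re
  have hC := hasDerivAt_cnR hq z.im
  have hW := (confFactor_pos hp hq hz).ne'
  have h1 := hasFDerivAt_const_mul_re_mul_im (2 * p * q) hc hC
  have h2 := ((hc.fun_pow 2).const_mul (p ^ 2)).hasFDerivAt_re.fun_sub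
    ((hC.fun_pow 2).const_mul (q ^ 2)).hasFDerivAt_im
  have h3 := (h1.mul_const (Real.cos (θ z))).fun_sub (h2.mul_const (Real.sin (θ z)))
  have h4 := h3.mul ((hasDerivAt_inv hW).comp_hasFDerivAt z (hasFDerivAt_confFactor hp hq z))
  obtain ⟨hcos, hsin⟩ := h.self_of_nhds
  have h0 : 2 * p * q * (cnR p z.re * cnR q z.im) * Real.cos (θ z) -
      (p ^ 2 * cnR p z.re ^ 2 - q ^ 2 * cnR q z.im ^ 2) * Real.sin (θ z) = 0 := by
    rw [← hcos, ← hsin]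
    ring
  -- Near `z` the difference `θ w - θ z` is the arc sine of a differentiable function.
  have heq : θ =ᶠ[nhds z] fun w => Real.arcsin ((2 * p * q * (cnR p w.re * cnR q w.im) *
      Real.cos (θ z) - (p ^ 2 * cnR p w.re ^ 2 - q ^ 2 * cnR q w.im ^ 2) * Real.sin (θ z)) *
      (confFactor p q w)⁻¹) + θ z := by
    have hnear := Metric.continuousAt_iff'.1 hθ (Real.pi / 2) (by positivity)
    filter_upwards [h, hnear, (isOpen_regularDomain hp hq).mem_nhds hz] with w hw hd hwΩ
    have hWw := (confFactor_pos hp hq hwΩ).ne'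
    rw [Real.dist_eq, abs_lt] at hd
    rw [← hw.1, ← hw.2]
    have : (confFactor p q w * Real.sin (θ w) * Real.cos (θ z) -
        confFactor p q w * Real.cos (θ w) * Real.sin (θ z)) * (confFactor p q w)⁻¹ =
        Real.sin (θ w - θ z) := by
      rw [Real.sin_sub]
      field_simp
    rw [this, Real.arcsin_sin (by linarith) (by linarith)]
    ring
  have harc : HasDerivAt Real.arcsin 1 ((2 * p * q * (cnR p z.re * cnR q z.im) *
      Real.cos (θ z) - (p ^ 2 * cnR p z.re ^ 2 - q ^ 2 * cnR q z.im ^ 2) * Real.sin (θ z)) *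
      (confFactor p q z)⁻¹) := by
    rw [h0, zero_mul]
    simpa using Real.hasDerivAt_arcsin (x := 0) (by norm_num) (by norm_num)
  refine (((harc.comp_hasFDerivAt z h4).add_const (θ z)).congr_of_eventuallyEq heq).congr_fderiv ?_
  have hcos' : Real.cos (θ z) =
      (p ^ 2 * cnR p z.re ^ 2 - q ^ 2 * cnR q z.im ^ 2) / confFactor p q z := by
    rw [← hcos, mul_div_cancel_left₀ _ hW]
  have hsin' : Real.sin (θ z) =
      2 * p * q * (cnR p z.re * cnR q z.im) / confFactor p q z := by
    rw [← hsin, mul_div_cancel_left₀ _ hW]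
  ext h
  simp only [one_smul, smul_apply, sub_apply,
    add_apply, coordForm_apply, smul_eq_mul, h0, zero_mul, zero_add,
    Function.comp_apply]
  rw [hcos', hsin']
  field_simp
  unfold confFactor
  push_cast
  ring

theorem IsDualBranch.hasFDerivAt {p q a b c : ℝ} {U : Set ℂ} {Y : ℂ → E3}
    (hp : p ∈ Set.Ioo (0 : ℝ) 1) (hq : q ∈ Set.Ioo (0 : ℝ) 1) (hpq : p ^ 2 + q ^ 2 = 1)
    (hb : b ≠ 0) (hY : IsDualBranch p q a b c U Y) {z : ℂ} (hz : z ∈ U) :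
    HasFDerivAt Y (coordMap ((2 / confFactor p q z) • ellipsoidParamU p q a b c z)
      (-(2 / confFactor p q z) • ellipsoidParamV p q a b c z)) z := by
  obtain ⟨hU, hUΩ, hYc, hval⟩ := (isDualBranch_iff hp hq hpq a hb c U Y).1 hY
  have hp0 := hp.1.ne'
  have hq0 := hq.1.ne'
  have hn := hU.mem_nhds hz
  have hc : ContinuousAt (fun w => Y w 1) z :=
    (EuclideanSpace.proj (𝕜 := ℝ) 1).continuous.continuousAt.comp (hYc.continuousAt hn)
  have h1 := (hasFDerivAt_of_cos_sin_eq hp hq (θ := fun w => p * q / b * Y w 1) (hUΩ hz)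
    (continuousAt_const.mul hc) (by
      filter_upwards [hn] with w hw
      exact (exp_mul_confFactor_eq_iff p q w _).1 (hval w hw).2.2)).const_mul (b / (p * q))
  refine hasFDerivAt_coordMap fun i => ?_
  fin_cases i
  · refine (((hasFDerivAt_dualFst hp hq hpq (hUΩ hz)).const_mul a).congr_of_eventuallyEq
      (f₁ := fun w => Y w 0) ?_).congr_fderiv ?_
    · filter_upwards [hn] with w hw using (hval w hw).1
    · ext h
      simp [ellipsoidParamU, ellipsoidParamV]
      ring
  · refine (h1.congr_of_eventuallyEq (f₁ := fun w => Y w 1) ?_).congr_fderiv ?_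
    · filter_upwards with w
      field_simp
    · ext h
      simp [ellipsoidParamU, ellipsoidParamV]
      field_simp
  · refine (((hasFDerivAt_dualThd hp hq hpq (hUΩ hz)).const_mul c).congr_of_eventuallyEq
      (f₁ := fun w => Y w 2) ?_).congr_fderiv ?_
    · filter_upwards [hn] with w hw using (hval w hw).2.1
    · ext h
      simp [ellipsoidParamU, ellipsoidParamV]
      ring

theorem IsDualBranch.contDiffOn {p q a b c : ℝ} {U : Set ℂ} {Y : ℂ → E3}
    (hp : p ∈ Set.Ioo (0 : ℝ) 1) (hq : q ∈ Set.Ioo (0 : ℝ) 1) (hpq : p ^ 2 + q ^ 2 = 1)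
    (hb : b ≠ 0) (hY : IsDualBranch p q a b c U Y) : ContDiffOn ℝ ∞ Y U := by
  have hW : ContDiffOn ℝ ∞ (fun z => 2 / confFactor p q z) U :=
    contDiffOn_const.div (contDiff_confFactor hp hq).contDiffOn
      fun z hz => (confFactor_pos hp hq (hY.2.1 hz)).ne'
  refine (contDiffOn_infty_iff_fderiv_of_isOpen hY.1).2 ⟨fun z hz =>
    (hY.hasFDerivAt hp hq hpq hb hz).differentiableAt.differentiableWithinAt, ?_⟩
  refine ContDiffOn.congr ?_ fun z hz => (hY.hasFDerivAt hp hq hpq hb hz).fderiv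
  exact (contDiffOn_const.smulRight (hW.smul (contDiff_ellipsoidParamU hp hq a b c).contDiffOn)).add
    (contDiffOn_const.smulRight
      (hW.neg.smul (contDiff_ellipsoidParamV hp hq a b c).contDiffOn))

theorem IsDualBranch.isChristoffelPair {p q r a c : ℝ} {U : Set ℂ} {Y : ℂ → E3}
    (hp : p ∈ Set.Ioo (0 : ℝ) 1) (hq : q ∈ Set.Ioo (0 : ℝ) 1) (hpq : p ^ 2 + q ^ 2 = 1)
    (hrq : r ^ 2 * q ^ 2 < 1) (ha : a ^ 2 = 1 + r ^ 2 * p ^ 2) (hc : c ^ 2 = 1 - r ^ 2 * q ^ 2)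
    (hY : IsDualBranch p q a 1 c U Y) : IsChristoffelPair (ellipsoidParam p q a 1 c) Y U := by
  refine ⟨(contDiff_ellipsoidParam hp hq a 1 c).contDiffOn,
    hY.contDiffOn hp hq hpq one_ne_zero, fun z hz => ?_⟩
  have hW := confFactor_pos hp hq (hY.2.1 hz)
  have hX := (hasFDerivAt_ellipsoidParam hp hq a 1 c z).fderiv
  have hdY := (hY.hasFDerivAt hp hq hpq one_ne_zero hz).fderiv
  have hort := inner_ellipsoidParamU_ellipsoidParamV hpq ha hc z
  refine ⟨((isCurvatureLineParam_ellipsoidParam hp hq hpq hrq ha hc).2 z (hY.2.1 hz)).1,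
    ⟨(2 / confFactor p q z) • Complex.conjAe.toLinearMap, ?_, fun h => ?_⟩,
    2 / confFactor p q z, by positivity, fun h => ?_⟩
  · rw [LinearMap.det_smul, Complex.det_conjAe, Complex.finrank_real_complex, mul_neg_one,
      neg_lt_zero]
    positivity
  · rw [hdY, hX]
    simp [smul_smul, mul_comm]
  · rw [hdY, hX, ← sq_eq_sq₀ (norm_nonneg _) (by positivity), mul_pow, norm_sq_coordMap hort,
      norm_sq_coordMap (by rw [inner_smul_left, inner_smul_right, hort]; simp), norm_smul,
      norm_smul, mul_pow, mul_pow, Real.norm_eq_abs, Real.norm_eq_abs, sq_abs, sq_abs]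
    ring

theorem IsDualBranch.isCurvatureLineParam {p q r a c : ℝ} {U : Set ℂ} {Y : ℂ → E3}
    (hp : p ∈ Set.Ioo (0 : ℝ) 1) (hq : q ∈ Set.Ioo (0 : ℝ) 1) (hpq : p ^ 2 + q ^ 2 = 1)
    (hrq : r ^ 2 * q ^ 2 < 1) (ha : a ^ 2 = 1 + r ^ 2 * p ^ 2) (hc : c ^ 2 = 1 - r ^ 2 * q ^ 2)
    (hY : IsDualBranch p q a 1 c U Y) : IsCurvatureLineParam Y U := by
  have hYu : ∀ z ∈ U, partialU Y z = (2 / confFactor p q z) • ellipsoidParamU p q a 1 c z := by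
    intro z hz
    simp [partialU, (hY.hasFDerivAt hp hq hpq one_ne_zero hz).fderiv]
  have hYv : ∀ z ∈ U, partialV Y z = -(2 / confFactor p q z) • ellipsoidParamV p q a 1 c z := by
    intro z hz
    simp [partialV, (hY.hasFDerivAt hp hq hpq one_ne_zero hz).fderiv]
  refine ⟨hY.contDiffOn hp hq hpq one_ne_zero, fun z hz => ?_⟩
  have hort := inner_ellipsoidParamU_ellipsoidParamV hpq ha hc z
  have hW := (confFactor_pos hp hq (hY.2.1 hz)).ne'
  have hV := ellipsoidParamV_ne_zero hp hq hpq hrq ha hc (hY.2.1 hz)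
  have hort' : inner ℝ ((2 / confFactor p q z) • ellipsoidParamU p q a 1 c z)
      (-(2 / confFactor p q z) • ellipsoidParamV p q a 1 c z) = 0 := by
    rw [inner_smul_left, inner_smul_right, hort]
    simp
  refine ⟨?_, by rwa [hYu z hz, hYv z hz], ?_⟩
  · rw [(hY.hasFDerivAt hp hq hpq one_ne_zero hz).fderiv]
    exact coordMap_injective hort'
      (smul_ne_zero (div_ne_zero two_ne_zero hW)
        (ellipsoidParamU_ne_zero hp hq hpq ha hc (hY.2.1 hz)))
      (smul_ne_zero (neg_ne_zero.2 (div_ne_zero two_ne_zero hW)) hV)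
  · -- The derivative of `-(2 / W) X_v` is tangential because that of `X_v` is.
    have hdiv : DifferentiableAt ℝ (fun w => -(2 / confFactor p q w)) z := by
      simp only [div_eq_mul_inv]
      exact (((hasFDerivAt_confFactor hp hq z).differentiableAt.fun_inv hW).const_mul 2).fun_neg
    have hVd : DifferentiableAt ℝ (ellipsoidParamV p q a 1 c) z :=
      ((contDiff_ellipsoidParamV hp hq a 1 c).differentiable (by simp)).differentiableAt
    have heq : partialV Y =ᶠ[nhds z]
        fun w => (-(2 / confFactor p q w)) • ellipsoidParamV p q a 1 c w := by
      filter_upwards [hY.1.mem_nhds hz] with w hw using hYv w hw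
    have hd : partialU (partialV Y) z =
        (-(2 / confFactor p q z)) • fderiv ℝ (ellipsoidParamV p q a 1 c) z 1 +
        (fderiv ℝ (fun w => -(2 / confFactor p q w)) z 1) • ellipsoidParamV p q a 1 c z := by
      rw [partialU, heq.fderiv_eq, (hdiv.hasFDerivAt.fun_smul hVd.hasFDerivAt).fderiv]
      simp
    rw [hd, hYu z hz, hYv z hz, fderiv_ellipsoidParamV_one hp hq hpq a 1 c (hY.2.1 hz)]
    set S := Submodule.span ℝ {(2 / confFactor p q z) • ellipsoidParamU p q a 1 c z,
      -(2 / confFactor p q z) • ellipsoidParamV p q a 1 c z} with hS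
    have hmU : ellipsoidParamU p q a 1 c z ∈ S := by
      rw [← Submodule.smul_mem_iff S (div_ne_zero two_ne_zero hW)]
      exact Submodule.subset_span (by simp)
    have hmV : ellipsoidParamV p q a 1 c z ∈ S := by
      rw [← Submodule.smul_mem_iff S (neg_ne_zero.2 (div_ne_zero two_ne_zero hW))]
      exact Submodule.subset_span (by simp)
    exact S.add_mem (S.smul_mem _ (S.add_mem (S.smul_mem _ hmU) (S.smul_mem _ hmV)))
      (S.smul_mem _ hmV)

/-! ### Uniqueness of the Christoffel dual -/

/-- A proportionality factor between the differentials of two maps, one of them an immersion, is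
locally constant, by the symmetry of second derivatives. -/
theorem exists_eq_smul_add_of_fderiv_eq_smul {U : Set ℂ} (hU : IsOpen U) (hUc : IsPreconnected U)
    {Y Z : ℂ → E3} (hY : ContDiffOn ℝ ∞ Y U) (hZ : ContDiffOn ℝ ∞ Z U)
    (hinj : ∀ z ∈ U, Function.Injective (fderiv ℝ Y z)) {κ : ℂ → ℝ}
    (hκ : ∀ z ∈ U, fderiv ℝ Z z = κ z • fderiv ℝ Y z) :
    ∃ (s : ℝ) (t : E3), ∀ z ∈ U, Z z = s • Y z + t := by
  have hdY := ((contDiffOn_infty_iff_fderiv_of_isOpen hU).1 hY).2.differentiableOn (by simp)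
  have hdZ := ((contDiffOn_infty_iff_fderiv_of_isOpen hU).1 hZ).2.differentiableOn (by simp)
  have hne : ∀ z ∈ U, fderiv ℝ Y z 1 ≠ 0 := fun z hz h0 =>
    one_ne_zero (hinj z hz (h0.trans (map_zero _).symm))
  have hκd : DifferentiableOn ℝ κ U := by
    have h1 : DifferentiableOn ℝ (fun z => fderiv ℝ Y z 1) U := fun z hz =>
      (hdY z hz).clm_apply (differentiableWithinAt_const _)
    have h2 : DifferentiableOn ℝ (fun z => fderiv ℝ Z z 1) U := fun z hz =>
      (hdZ z hz).clm_apply (differentiableWithinAt_const _)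
    refine DifferentiableOn.congr (f := fun z => inner ℝ (fderiv ℝ Z z 1) (fderiv ℝ Y z 1) *
      (inner ℝ (fderiv ℝ Y z 1) (fderiv ℝ Y z 1))⁻¹) ?_ fun z hz => ?_
    · exact (h2.inner ℝ h1).fun_mul ((h1.inner ℝ h1).fun_inv
        fun z hz => inner_self_ne_zero.2 (hne z hz))
    · rw [hκ z hz, smul_apply, real_inner_smul_left,
        mul_inv_cancel_right₀ (inner_self_ne_zero.2 (hne z hz))]
  have hκ0 : Set.EqOn (fderiv ℝ κ) 0 U := by
    intro z hz
    have hn := hU.mem_nhds hz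
    have heq : fderiv ℝ Z =ᶠ[nhds z] fun w => κ w • fderiv ℝ Y w := by
      filter_upwards [hn] with w hw using hκ w hw
    have hd := ((hκd.differentiableAt hn).hasFDerivAt.fun_smul
      (hdY.differentiableAt hn).hasFDerivAt).fderiv
    have hsm : minSmoothness ℝ 2 ≤ ∞ := by
      rw [minSmoothness_of_isRCLikeNormedField]
      exact WithTop.coe_le_coe.2 (le_top : (2 : ℕ∞) ≤ ⊤)
    have hsY : IsSymmSndFDerivAt ℝ Y z := (hY.contDiffAt hn).isSymmSndFDerivAt hsm
    have hsZ : IsSymmSndFDerivAt ℝ Z z := (hZ.contDiffAt hn).isSymmSndFDerivAt hsm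
    have h1 : fderiv ℝ κ z Complex.I • fderiv ℝ Y z 1 =
        fderiv ℝ κ z 1 • fderiv ℝ Y z Complex.I := by
      have h2 := hsZ.eq Complex.I 1
      rw [heq.fderiv_eq, hd] at h2
      simpa [hsY.eq Complex.I 1] using h2
    have h3 : (⟨fderiv ℝ κ z Complex.I, -fderiv ℝ κ z 1⟩ : ℂ) = 0 := by
      apply hinj z hz
      have h4 : (⟨fderiv ℝ κ z Complex.I, -fderiv ℝ κ z 1⟩ : ℂ) =
          fderiv ℝ κ z Complex.I • (1 : ℂ) - fderiv ℝ κ z 1 • Complex.I := by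
        apply Complex.ext <;> simp
      rw [h4, map_sub, map_smul, map_smul, h1, sub_self, map_zero]
    have h5 := Complex.ext_iff.1 h3
    simp only [Complex.zero_re, Complex.zero_im, neg_eq_zero] at h5
    ext h
    have h6 : h = h.re • (1 : ℂ) + h.im • Complex.I := by
      apply Complex.ext <;> simp
    rw [h6, map_add, map_smul, map_smul, h5.1, h5.2]
    simp
  rcases U.eq_empty_or_nonempty with rfl | ⟨z₀, hz₀⟩
  · exact ⟨0, 0, by simp⟩
  have hconst : ∀ z ∈ U, κ z = κ z₀ := fun z hz =>
    hU.is_const_of_fderiv_eq_zero hUc hκd hκ0 hz hz₀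
  have hYd := hY.differentiableOn (by simp : (∞ : WithTop ℕ∞) ≠ 0)
  have hZd := hZ.differentiableOn (by simp : (∞ : WithTop ℕ∞) ≠ 0)
  obtain ⟨t, ht⟩ := hU.exists_is_const_of_fderiv_eq_zero hUc
    (f := fun z => Z z - κ z₀ • Y z) (𝕜 := ℝ) (hZd.fun_sub (hYd.fun_const_smul (κ z₀))) (by
      intro z hz
      have hn := hU.mem_nhds hz
      rw [fderiv_fun_sub (hZd.differentiableAt hn) ((hYd.differentiableAt hn).fun_const_smul _),
        fderiv_fun_const_smul (hYd.differentiableAt hn), hκ z hz, hconst z hz]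
      simp)
  exact ⟨κ z₀, t, fun z hz => by rw [← ht z hz]; abel⟩

/-- A `2 × 2` matrix with columns `(α, m)` and `(m', δ)` that is orientation reversing and
conformal for the quadratic form `E x² + G y²`, with factor `μ`. -/
theorem conformal_reversing_entries {α m m' δ E G μ : ℝ} (hE : 0 < E) (hG : 0 < G) (hμ : 0 < μ)
    (hdet : α * δ - m * m' < 0) (h1 : α ^ 2 * E + m ^ 2 * G = μ ^ 2 * E)
    (h2 : m' ^ 2 * E + δ ^ 2 * G = μ ^ 2 * G) (h3 : α * m' * E + m * δ * G = 0) :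
    m' * E = m * G ∧ δ = -α := by
  have hμE : μ ^ 2 * E ≠ 0 := by positivity
  have hsq : (α * δ - m * m') ^ 2 = (μ ^ 2) ^ 2 := by
    have hEG : E * G ≠ 0 := by positivity
    have : (α * δ - m * m') ^ 2 * (E * G) = (μ ^ 2) ^ 2 * (E * G) := by
      linear_combination (m' ^ 2 * E + δ ^ 2 * G) * h1 + μ ^ 2 * E * h2 -
        (α * m' * E + m * δ * G) * h3
    exact mul_right_cancel₀ hEG this
  have hΔ : α * δ - m * m' = -μ ^ 2 := by
    rcases sq_eq_sq_iff_eq_or_eq_neg.1 hsq with h | h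
    · nlinarith [sq_nonneg μ]
    · exact h
  constructor
  · refine mul_right_cancel₀ (pow_pos hμ 2).ne' ?_
    have : m' * (μ ^ 2 * E) = μ ^ 2 * (m * G) := by
      linear_combination -m' * h1 + α * h3 - m * G * hΔ
    linear_combination this
  · refine mul_right_cancel₀ hμE ?_
    linear_combination -δ * h1 + m * h3 + α * E * hΔ

/-- A normal field of the ellipsoid is the parametrization of the ellipsoid with reciprocal half
axes. The corresponding second fundamental form is, up to sign, `confFactor` times
`du² + dv²`. -/
theorem inner_ellipsoidParam_inv {p q a c : ℝ} (hp : p ∈ Set.Ioo (0 : ℝ) 1)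
    (hq : q ∈ Set.Ioo (0 : ℝ) 1) (hpq : p ^ 2 + q ^ 2 = 1) (ha : a ≠ 0) (hc : c ≠ 0) (z : ℂ) :
    inner ℝ (ellipsoidParam p q a⁻¹ 1 c⁻¹ z) (ellipsoidParamU p q a 1 c z) = 0 ∧
    inner ℝ (ellipsoidParam p q a⁻¹ 1 c⁻¹ z) (ellipsoidParamV p q a 1 c z) = 0 ∧
    inner ℝ (ellipsoidParamU p q a⁻¹ 1 c⁻¹ z) (ellipsoidParamU p q a 1 c z) =
      confFactor p q z ∧
    inner ℝ (ellipsoidParamV p q a⁻¹ 1 c⁻¹ z) (ellipsoidParamV p q a 1 c z) =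
      confFactor p q z ∧
    inner ℝ (ellipsoidParamU p q a⁻¹ 1 c⁻¹ z) (ellipsoidParamV p q a 1 c z) = 0 ∧
    inner ℝ (ellipsoidParamV p q a⁻¹ 1 c⁻¹ z) (ellipsoidParamU p q a 1 c z) = 0 := by
  have e1 := snR_sq_add_cnR_sq p z.re
  have e2 := snR_sq_add_cnR_sq q z.im
  have e3 := dnR_sq hp z.re
  have e4 := dnR_sq hq z.im
  simp only [real_inner_E3, ellipsoidParam, ellipsoidParamU, ellipsoidParamV,
    Matrix.cons_val, confFactor]
  refine ⟨?_, ?_, ?_, ?_, ?_, ?_⟩ <;> field_simp <;> grind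

/-- If the tangent planes of `Z` are parallel to those of the surface with normal field `N`, then
`⟨N_v, Z_u⟩ = ⟨N_u, Z_v⟩`, since both are the negative of `⟨N, Z_uv⟩`. -/
theorem inner_fderiv_normal_symm {U : Set ℂ} (hU : IsOpen U) {N Z : ℂ → E3}
    (hN : DifferentiableOn ℝ N U) (hZ : ContDiffOn ℝ ∞ Z U)
    (h : ∀ z ∈ U, ∀ k, inner ℝ (N z) (fderiv ℝ Z z k) = 0) {z : ℂ} (hz : z ∈ U) (k l : ℂ) :
    inner ℝ (fderiv ℝ N z k) (fderiv ℝ Z z l) = inner ℝ (fderiv ℝ N z l) (fderiv ℝ Z z k) := by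
  have hn := hU.mem_nhds hz
  have hdZ := (((contDiffOn_infty_iff_fderiv_of_isOpen hU).1 hZ).2.differentiableOn
    (by simp)).differentiableAt hn
  have hsm : minSmoothness ℝ 2 ≤ ∞ := by
    rw [minSmoothness_of_isRCLikeNormedField]
    exact WithTop.coe_le_coe.2 (le_top : (2 : ℕ∞) ≤ ⊤)
  have hsZ : IsSymmSndFDerivAt ℝ Z z := (hZ.contDiffAt hn).isSymmSndFDerivAt hsm
  have key : ∀ k l : ℂ, inner ℝ (N z) (fderiv ℝ (fderiv ℝ Z) z k l) +
      inner ℝ (fderiv ℝ N z k) (fderiv ℝ Z z l) = 0 := by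
    intro k l
    have heq : (fun w => inner ℝ (N w) (fderiv ℝ Z w l)) =ᶠ[nhds z] fun _ => 0 := by
      filter_upwards [hn] with w hw using h w hw l
    have h1 := fderiv_inner_apply ℝ (hN.differentiableAt hn)
      (hdZ.clm_apply (differentiableAt_const l)) k
    rw [heq.fderiv_eq, (hdZ.hasFDerivAt.clm_apply (hasFDerivAt_const l z)).fderiv] at h1
    simpa using h1.symm
  have h1 := key k l
  have h2 := key l k
  rw [hsZ.eq k l] at h1
  linarith

/-- The differentials of the Christoffel duals of the ellipsoid are proportional to
`(X_u, -X_v)`. As the ellipsoid has no umbilics on the regular domain, its curvature line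
parameters are necessarily curvature line parameters of the dual. -/
theorem IsChristoffelPair.exists_fderiv_eq {p q r a c : ℝ} {U : Set ℂ} {Z : ℂ → E3}
    (hp : p ∈ Set.Ioo (0 : ℝ) 1) (hq : q ∈ Set.Ioo (0 : ℝ) 1) (hpq : p ^ 2 + q ^ 2 = 1)
    (hr : r ≠ 0) (hrq : r ^ 2 * q ^ 2 < 1) (ha0 : a ≠ 0) (hc0 : c ≠ 0)
    (ha : a ^ 2 = 1 + r ^ 2 * p ^ 2) (hc : c ^ 2 = 1 - r ^ 2 * q ^ 2) (hU : IsOpen U)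
    (hUΩ : U ⊆ regularDomain p q) (hZ : IsChristoffelPair (ellipsoidParam p q a 1 c) Z U)
    {z : ℂ} (hz : z ∈ U) : ∃ α : ℝ, fderiv ℝ Z z =
      α • coordMap (ellipsoidParamU p q a 1 c z) (-ellipsoidParamV p q a 1 c z) := by
  have hX := fun w => (hasFDerivAt_ellipsoidParam hp hq a 1 c w).fderiv
  have hW := confFactor_pos hp hq (hUΩ hz)
  obtain ⟨-, ⟨A, hdet, hA⟩, μ, hμ, hconf⟩ := hZ.2.2 z hz
  have hort := inner_ellipsoidParamU_ellipsoidParamV hpq ha hc z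
  have hE := pow_pos (norm_pos_iff.2 (ellipsoidParamU_ne_zero hp hq hpq ha hc (hUΩ hz))) 2
  have hG := pow_pos (norm_pos_iff.2 (ellipsoidParamV_ne_zero hp hq hpq hrq ha hc (hUΩ hz))) 2
  have hnorm : ∀ h, (A h).re ^ 2 * ‖ellipsoidParamU p q a 1 c z‖ ^ 2 +
      (A h).im ^ 2 * ‖ellipsoidParamV p q a 1 c z‖ ^ 2 = μ ^ 2 *
      (h.re ^ 2 * ‖ellipsoidParamU p q a 1 c z‖ ^ 2 +
        h.im ^ 2 * ‖ellipsoidParamV p q a 1 c z‖ ^ 2) := by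
    intro h
    rw [← norm_sq_coordMap hort, ← norm_sq_coordMap hort, ← hX, ← hA, hconf, mul_pow]
  have h1 := hnorm 1
  have h2 := hnorm Complex.I
  have h3 := hnorm (1 + Complex.I)
  rw [map_add] at h3
  simp only [Complex.add_re, Complex.add_im, Complex.one_re, Complex.one_im, Complex.I_re,
    Complex.I_im] at h1 h2 h3
  have hdet' : LinearMap.det A = (A 1).re * (A Complex.I).im - (A 1).im * (A Complex.I).re := by
    rw [← LinearMap.det_toMatrix Complex.basisOneI, Matrix.det_fin_two]
    simp [LinearMap.toMatrix_apply, mul_comm]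
  rw [hdet'] at hdet
  obtain ⟨hm, hδ⟩ := conformal_reversing_entries hE hG hμ hdet (by linarith) (by linarith)
    (by linarith)
  -- Parallel tangent planes and the symmetry of `Z_uv` give a second relation of the
  -- off-diagonal entries. It contradicts the first unless they vanish, since the principal
  -- curvatures differ.
  have hN : ∀ w, fderiv ℝ (ellipsoidParam p q a⁻¹ 1 c⁻¹) w = _ := fun w =>
    (hasFDerivAt_ellipsoidParam hp hq a⁻¹ 1 c⁻¹ w).fderiv
  have hsymm := inner_fderiv_normal_symm hU (N := ellipsoidParam p q a⁻¹ 1 c⁻¹)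
    (fun w _ => (hasFDerivAt_ellipsoidParam hp hq a⁻¹ 1 c⁻¹
      w).differentiableAt.differentiableWithinAt) hZ.2.1 (by
      intro w hw k
      obtain ⟨-, ⟨B, -, hB⟩, -⟩ := hZ.2.2 w hw
      obtain ⟨n1, n2, -⟩ := inner_ellipsoidParam_inv hp hq hpq ha0 hc0 w
      rw [hB, hX, coordMap_apply, inner_add_right, inner_smul_right, inner_smul_right, n1, n2]
      simp) hz Complex.I 1
  obtain ⟨-, -, n3, n4, n5, n6⟩ := inner_ellipsoidParam_inv hp hq hpq ha0 hc0 z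
  rw [hN, hA, hA, hX] at hsymm
  simp only [coordMap_apply, Complex.I_re, Complex.I_im, Complex.one_re, Complex.one_im, zero_smul,
    one_smul, zero_add, add_zero, inner_add_right, inner_smul_right, n3, n4, n5, n6, mul_zero,
    mul_left_inj' hW.ne'] at hsymm
  have hEG : ‖ellipsoidParamU p q a 1 c z‖ ^ 2 - ‖ellipsoidParamV p q a 1 c z‖ ^ 2 =
      r ^ 2 * confFactor p q z ^ 2 := by
    rw [norm_sq_ellipsoidParamU hp hq hpq ha hc, norm_sq_ellipsoidParamV hp hq hpq ha hc]
    unfold confFactor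
    ring
  have hm0 : (A 1).im = 0 := by
    rw [← hsymm] at hm
    have : (A 1).im * (r ^ 2 * confFactor p q z ^ 2) = 0 := by rw [← hEG]; linarith
    exact (mul_eq_zero.1 this).resolve_right (by positivity)
  refine ⟨(A 1).re, ?_⟩
  ext1 h
  have hh : h = h.re • (1 : ℂ) + h.im • Complex.I := by
    apply Complex.ext <;> simp
  rw [hA, hX, coordMap_apply, smul_apply, coordMap_apply]
  have hAh : A h = h.re • A 1 + h.im • A Complex.I := by
    conv_lhs => rw [hh]
    rw [map_add, map_smul, map_smul]
  rw [hAh]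
  simp only [Complex.add_re, Complex.add_im, Complex.smul_re, Complex.smul_im, hm0, ← hsymm, hδ,
    smul_eq_mul]
  module

theorem IsDualBranch.isChristoffelPair_iff {p q r a c : ℝ} {U : Set ℂ} {Y : ℂ → E3}
    (hp : p ∈ Set.Ioo (0 : ℝ) 1) (hq : q ∈ Set.Ioo (0 : ℝ) 1) (hpq : p ^ 2 + q ^ 2 = 1)
    (hr : r ≠ 0) (hrq : r ^ 2 * q ^ 2 < 1) (ha0 : a ≠ 0) (hc0 : c ≠ 0)
    (ha : a ^ 2 = 1 + r ^ 2 * p ^ 2) (hc : c ^ 2 = 1 - r ^ 2 * q ^ 2)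
    (hY : IsDualBranch p q a 1 c U Y) (hUc : IsPreconnected U) (Z : ℂ → E3) :
    IsChristoffelPair (ellipsoidParam p q a 1 c) Z U ↔
      ∃ (s : ℝ) (t : E3), s ≠ 0 ∧ ∀ z ∈ U, Z z = s • Y z + t := by
  have hYC := hY.isChristoffelPair hp hq hpq hrq ha hc
  have hYd := hYC.2.1.differentiableOn (by simp)
  have hderiv : ∀ (s : ℝ) (t : E3), (∀ z ∈ U, Z z = s • Y z + t) →
      ∀ z ∈ U, fderiv ℝ Z z = s • fderiv ℝ Y z := by
    intro s t h z hz
    have heq : Z =ᶠ[nhds z] fun w => s • Y w + t := by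
      filter_upwards [hY.1.mem_nhds hz] with w hw using h w hw
    rw [heq.fderiv_eq, fderiv_add_const,
      fderiv_fun_const_smul (hYd.differentiableAt (hY.1.mem_nhds hz))]
  constructor
  · intro hZ
    rcases U.eq_empty_or_nonempty with rfl | ⟨z₀, hz₀⟩
    · exact ⟨1, 0, one_ne_zero, by simp⟩
    choose! α hα using fun z (hz : z ∈ U) =>
      hZ.exists_fderiv_eq hp hq hpq hr hrq ha0 hc0 ha hc hY.1 hY.2.1 hz
    obtain ⟨s, t, hst⟩ := exists_eq_smul_add_of_fderiv_eq_smul hY.1 hUc hYC.2.1 hZ.2.1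
      (κ := fun z => α z * (confFactor p q z / 2))
      (fun z hz => ((hY.isCurvatureLineParam hp hq hpq hrq ha hc).2 z hz).1) (by
        intro z hz
        have hW := (confFactor_pos hp hq (hY.2.1 hz)).ne'
        rw [hα z hz, (hY.hasFDerivAt hp hq hpq one_ne_zero hz).fderiv]
        have h2 : α z * (confFactor p q z / 2) * (2 / confFactor p q z) = α z := by field_simp
        ext1 h
        simp only [smul_apply, coordMap_apply, smul_add, smul_smul, smul_neg, neg_smul]
        rw [mul_left_comm _ h.re, mul_left_comm _ h.im, h2, mul_comm h.re, mul_comm h.im])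
    refine ⟨s, t, ?_, hst⟩
    rintro rfl
    obtain ⟨hinj, -, μ, hμ, hconf⟩ := hZ.2.2 z₀ hz₀
    have h1 := hconf 1
    have h2 : fderiv ℝ Z z₀ 1 = 0 := by
      rw [hderiv 0 t hst z₀ hz₀]
      simp
    rw [h2, norm_zero, eq_comm, mul_eq_zero, norm_eq_zero] at h1
    exact one_ne_zero (hinj ((h1.resolve_left hμ.ne').trans (map_zero _).symm))
  · rintro ⟨s, t, hs, h⟩
    refine ⟨hYC.1, ((hYC.2.1.const_smul s).add contDiffOn_const).congr h, fun z hz => ?_⟩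
    obtain ⟨hinj, ⟨A, hdet, hA⟩, μ, hμ, hconf⟩ := hYC.2.2 z hz
    refine ⟨hinj, ⟨s • A, ?_, fun k => ?_⟩, |s| * μ, by positivity, fun k => ?_⟩
    · rw [LinearMap.det_smul, Complex.finrank_real_complex]
      exact mul_neg_of_pos_of_neg (by positivity) hdet
    · rw [hderiv s t h z hz, smul_apply, hA, LinearMap.smul_apply, map_smul]
    · rw [hderiv s t h z hz, smul_apply, norm_smul, hconf, Real.norm_eq_abs, mul_assoc]

/-! ### Existence of branches and the Scherk tower -/

theorem exists_isDualBranch {p q b : ℝ} (hp : p ∈ Set.Ioo (0 : ℝ) 1) (hq : q ∈ Set.Ioo (0 : ℝ) 1)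
    (hpq : p ^ 2 + q ^ 2 = 1) (a : ℝ) (hb : b ≠ 0) (c : ℝ) {U : Set ℂ} (hU : IsOpen U)
    (hUs : IsSimplyConnected U) (hUΩ : U ⊆ regularDomain p q) :
    ∃ Y : ℂ → E3, IsDualBranch p q a b c U Y := by
  have hp0 := hp.1.ne'
  have hq0 := hq.1.ne'
  have hG : (0 : ℂ) ∉ (fun z => cnVector p q z ^ 2) '' U := by
    rintro ⟨z, hz, h0⟩
    have hW := confFactor_pos hp hq (hUΩ hz)
    rw [← normSq_cnVector, pow_eq_zero_iff two_ne_zero |>.1 h0, map_zero] at hW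
    exact hW.false
  obtain ⟨f, hf, hexp⟩ := Complex.exists_continuousOn_eqOn_exp_comp hUs hU
    ((continuous_cnVector hp hq).pow 2).continuousOn hG
  refine ⟨fun z => !₂[a * dualFst p q z, b / (p * q) * (f z).im, c * dualThd p q z],
    (isDualBranch_iff hp hq hpq a hb c U _).2 ⟨hU, hUΩ, ?_, fun z hz => ⟨rfl, rfl, ?_⟩⟩⟩
  · refine (PiLp.continuous_toLp 2 _).comp_continuousOn (continuousOn_pi.2 fun i => ?_)
    fin_cases i
    · exact continuousOn_const.mul fun z hz =>
        (hasFDerivAt_dualFst hp hq hpq (hUΩ hz)).continuousAt.continuousWithinAt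
    · exact continuousOn_const.mul (Complex.continuous_im.comp_continuousOn hf)
    · exact continuousOn_const.mul fun z hz =>
        (hasFDerivAt_dualThd hp hq hpq (hUΩ hz)).continuousAt.continuousWithinAt
  · have h1 : Complex.exp (f z) = cnVector p q z ^ 2 := hexp hz
    have h2 : Real.exp (f z).re = confFactor p q z := by
      rw [← Complex.norm_exp, h1, norm_pow, Complex.sq_norm, normSq_cnVector]
    have h3 : p * q / b * (b / (p * q) * (f z).im) = (f z).im := by field_simp
    simp only [Matrix.cons_val]
    rw [h3, ← h1, ← h2, Complex.ofReal_exp, ← Complex.exp_add, add_comm, Complex.re_add_im]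

theorem exists_isDualBranch_of_isDualValue {p q b : ℝ} (hp : p ∈ Set.Ioo (0 : ℝ) 1)
    (hq : q ∈ Set.Ioo (0 : ℝ) 1) (hpq : p ^ 2 + q ^ 2 = 1) (a : ℝ) (hb : b ≠ 0) (c : ℝ) {z : ℂ}
    (hz : z ∈ regularDomain p q) {y : E3} (hy : IsDualValue p q a b c z y) :
    ∃ (U : Set ℂ) (Y : ℂ → E3), IsDualBranch p q a b c U Y ∧ y ∈ Y '' U := by
  obtain ⟨ε, hε, hball⟩ := Metric.isOpen_iff.1 (isOpen_regularDomain hp hq) z hz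
  have hzb : z ∈ Metric.ball z ε := Metric.mem_ball_self hε
  have hs : IsSimplyConnected (Metric.ball z ε) := by
    have := (convex_ball z ε).contractibleSpace ⟨z, hzb⟩
    exact SimplyConnectedSpace.ofContractible _
  obtain ⟨Y, hY⟩ := exists_isDualBranch hp hq hpq a hb c Metric.isOpen_ball hs hball
  obtain ⟨-, -, hYc, hval⟩ := (isDualBranch_iff hp hq hpq a hb c _ Y).1 hY
  have hW : ((confFactor p q z : ℝ) : ℂ) ≠ 0 :=
    Complex.ofReal_ne_zero.2 (confFactor_pos hp hq hz).ne'
  -- The branch is shifted in the second component to attain the given value at `z`.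
  have hper : Complex.exp ((p * q / b * (y 1 - Y z 1) : ℝ) * Complex.I) = 1 := by
    rw [mul_sub, Complex.ofReal_sub, sub_mul, Complex.exp_sub,
      mul_right_cancel₀ hW (hy.2.2.trans (hval z hzb).2.2.symm), div_self (Complex.exp_ne_zero _)]
  refine ⟨Metric.ball z ε, fun w => Y w + !₂[0, y 1 - Y z 1, 0],
    (isDualBranch_iff hp hq hpq a hb c _ _).2 ⟨Metric.isOpen_ball, hball,
      hYc.add continuousOn_const, fun w hw => ⟨?_, ?_, ?_⟩⟩, z, hzb, ?_⟩
  · simpa using (hval w hw).1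
  · simpa using (hval w hw).2.1
  · rw [← (hval w hw).2.2]
    simp only [PiLp.add_apply, Matrix.cons_val]
    rw [mul_add, Complex.ofReal_add, add_mul, Complex.exp_add, hper, mul_one]
  · ext i
    fin_cases i
    · simpa using (hval z hzb).1.trans hy.1.symm
    · simp
    · simpa using (hval z hzb).2.1.trans hy.2.1.symm

theorem cosh_log_sub_log {x y : ℝ} (hx : 0 < x) (hy : 0 < y) :
    Real.cosh (Real.log x - Real.log y) = (x ^ 2 + y ^ 2) / (2 * (x * y)) := by
  rw [← Real.log_div hx.ne' hy.ne', Real.cosh_log (div_pos hx hy)]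
  field_simp

theorem IsDualValue.mem_image_scherkTower {p q a b c : ℝ} (hp : p ∈ Set.Ioo (0 : ℝ) 1)
    (hq : q ∈ Set.Ioo (0 : ℝ) 1) (hpq : p ^ 2 + q ^ 2 = 1) (hb : b ≠ 0) {z : ℂ}
    (hz : z ∈ regularDomain p q) {y : E3} (hy : IsDualValue p q a b c z y) :
    y ∈ scaleAxes a b c '' scherkTower p q := by
  have hp0 := hp.1.ne'
  have hq0 := hq.1.ne'
  obtain ⟨h0, h2, h1⟩ := hy
  have hcos := ((exp_mul_confFactor_eq_iff p q z _).1 h1).1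
  have hW := (confFactor_pos hp hq hz).ne'
  refine ⟨!₂[dualFst p q z, y 1 / b, dualThd p q z], ?_, ?_⟩
  · have hl1 := abs_lt.1 (abs_mul_snR_re_lt hp hq hpq hz)
    have hl2 := abs_lt.1 (abs_mul_snR_im_lt hp hq hpq hz)
    have e1 := snR_sq_add_cnR_sq p z.re
    have e2 := snR_sq_add_cnR_sq q z.im
    have e3 := dnR_sq hp z.re
    have e4 := dnR_sq hq z.im
    have hc1 : Real.cosh (p * dualFst p q z) =
        (dnR q z.im ^ 2 + (p * snR p z.re) ^ 2) / confFactor p q z := by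
      rw [dualFst, ← mul_assoc, mul_one_div_cancel hp0, one_mul,
        cosh_log_sub_log (by linarith) (by linarith), ← sq_sub_sq, ← confFactor_eq_dnR_im hq hpq]
      field_simp
      ring
    have hc2 : Real.cosh (q * dualThd p q z) =
        (dnR p z.re ^ 2 + (q * snR q z.im) ^ 2) / confFactor p q z := by
      rw [dualThd, ← mul_assoc, mul_one_div_cancel hq0, one_mul,
        cosh_log_sub_log (by linarith) (by linarith), ← sq_sub_sq, ← confFactor_eq_dnR_re hp hpq]
      field_simp
      ring
    have hc3 : Real.cos (p * q * (y 1 / b)) =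
        (p ^ 2 * cnR p z.re ^ 2 - q ^ 2 * cnR q z.im ^ 2) / confFactor p q z := by
      rw [← hcos, mul_div_cancel_left₀ _ hW]
      congr 1
      ring
    simp only [scherkTower, Set.mem_ofPred_eq, Matrix.cons_val]
    rw [hc1, hc2, hc3]
    field_simp
    grind
  · ext i
    fin_cases i
    · simpa [scaleAxes] using h0.symm
    · simp [scaleAxes, mul_div_cancel₀ _ hb]
    · simpa [scaleAxes] using h2.symm

/-- Every point of the Scherk tower is attained. With `α = p x₀ / 2`, `β = q x₂ / 2`,
`θ = p q x₁ / 2` and `M² = cosh² β + sinh² α`, the preimage is found from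
`(p sn u, p cn u) = (sinh α, cos θ) / M` and `(q sn v, q cn v) = (sinh β, sin θ) / M`. -/
theorem exists_isDualValue_scaleAxes {p q b : ℝ} (hp : p ∈ Set.Ioo (0 : ℝ) 1)
    (hq : q ∈ Set.Ioo (0 : ℝ) 1) (hpq : p ^ 2 + q ^ 2 = 1) (a : ℝ) (hb : b ≠ 0) (c : ℝ) {x : E3}
    (hx : x ∈ scherkTower p q) :
    ∃ z ∈ regularDomain p q, IsDualValue p q a b c z (scaleAxes a b c x) := by
  have hp0 := hp.1.ne'
  have hq0 := hq.1.ne'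
  obtain ⟨α, hα⟩ : ∃ α, p * x 0 = 2 * α := ⟨p * x 0 / 2, by ring⟩
  obtain ⟨β, hβ⟩ : ∃ β, q * x 2 = 2 * β := ⟨q * x 2 / 2, by ring⟩
  obtain ⟨θ, hθ⟩ : ∃ θ, p * q * x 1 = 2 * θ := ⟨p * q * x 1 / 2, by ring⟩
  have hchα := Real.cosh_pos α
  have hchβ := Real.cosh_pos β
  have eα := Real.cosh_sq α
  have eβ := Real.cosh_sq β
  have eθ := Real.sin_sq_add_cos_sq θ
  have hMpos : 0 < Real.cosh β ^ 2 + Real.sinh α ^ 2 := by positivity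
  obtain ⟨M, hM, hM2⟩ : ∃ M : ℝ, 0 < M ∧ M ^ 2 = Real.cosh β ^ 2 + Real.sinh α ^ 2 :=
    ⟨_, Real.sqrt_pos.2 hMpos, Real.sq_sqrt hMpos.le⟩
  have hM0 := hM.ne'
  rw [scherkTower, Set.mem_ofPred_eq, hα, hβ, hθ, Real.cosh_two_mul, Real.cosh_two_mul,
    Real.cos_two_mul] at hx
  obtain ⟨u, hu, hu'⟩ := exists_snR_cnR_eq hp (s := Real.sinh α / (p * M))
    (c := Real.cos θ / (p * M)) (by field_simp; grind)
  obtain ⟨v, hv, hv'⟩ := exists_snR_cnR_eq hq (s := Real.sinh β / (q * M))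
    (c := Real.sin θ / (q * M)) (by field_simp; grind)
  have hdu : dnR p u = Real.cosh β / M := by
    rw [← sq_eq_sq₀ (dnR_pos hp u).le (by positivity), dnR_sq hp, hu]
    field_simp
    linarith
  have hdv : dnR q v = Real.cosh α / M := by
    rw [← sq_eq_sq₀ (dnR_pos hq v).le (by positivity), dnR_sq hq, hv]
    field_simp
    linarith
  have hlog : ∀ t : ℝ, Real.log (Real.cosh t / M + Real.sinh t / M) -
      Real.log (Real.cosh t / M - Real.sinh t / M) = 2 * t := by
    intro t
    rw [← add_div, ← sub_div, Real.cosh_add_sinh, Real.cosh_sub_sinh,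
      Real.log_div (Real.exp_pos _).ne' hM0, Real.log_div (Real.exp_pos _).ne' hM0, Real.log_exp,
      Real.log_exp]
    ring
  refine ⟨⟨u, v⟩, ?_, ?_, ?_, ?_⟩
  · by_contra hn
    simp only [regularDomain, Set.mem_ofPred_eq, not_or, not_not, hu', hv', div_eq_zero_iff,
      mul_eq_zero, hp0, hq0, hM0, or_false] at hn
    rw [hn.1, hn.2] at eθ
    norm_num at eθ
  · have h1 : p * (Real.sinh α / (p * M)) = Real.sinh α / M := by field_simp
    simp only [scaleAxes, dualFst, hu, hdv, h1, hlog, ← hα, Matrix.cons_val]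
    field_simp
  · have h1 : q * (Real.sinh β / (q * M)) = Real.sinh β / M := by field_simp
    simp only [scaleAxes, dualThd, hv, hdu, h1, hlog, ← hβ, Matrix.cons_val]
    field_simp
  · have h1 : p * q / b * (b * x 1) = 2 * θ := by
      rw [← hθ]
      field_simp
    simp only [scaleAxes, Matrix.cons_val]
    rw [exp_mul_confFactor_eq_iff, h1, Real.cos_two_mul, Real.sin_two_mul, confFactor]
    simp only [hu', hv']
    constructor
    · field_simp
      grind
    · field_simp
      grind

theorem setOf_mem_dualBranch_eq {p q b : ℝ} (hp : p ∈ Set.Ioo (0 : ℝ) 1)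
    (hq : q ∈ Set.Ioo (0 : ℝ) 1) (hpq : p ^ 2 + q ^ 2 = 1) (a : ℝ) (hb : b ≠ 0) (c : ℝ) :
    {x : E3 | ∃ (U : Set ℂ) (Y : ℂ → E3), IsDualBranch p q a b c U Y ∧ x ∈ Y '' U} =
      scaleAxes a b c '' scherkTower p q := by
  ext y
  constructor
  · rintro ⟨U, Y, hY, z, hz, rfl⟩
    exact (((isDualBranch_iff hp hq hpq a hb c U Y).1 hY).2.2.2 z hz).mem_image_scherkTower hp hq
      hpq hb (hY.2.1 hz)
  · rintro ⟨x, hx, rfl⟩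
    obtain ⟨z, hz, hval⟩ := exists_isDualValue_scaleAxes hp hq hpq a hb c hx
    exact exists_isDualBranch_of_isDualValue hp hq hpq a hb c hz hval

theorem mainTheorem3 (p q r : ℝ) (hp : p ∈ Set.Ioo (0 : ℝ) 1) (hq : q ∈ Set.Ioo (0 : ℝ) 1)
    (hpq : p ^ 2 + q ^ 2 = 1) (hr : r ∈ Set.Ioo (0 : ℝ) (1 / q)) (a b c : ℝ)
    (ha : a = √(1 + r ^ 2 * p ^ 2)) (hb : b = 1) (hc : c = √(1 - r ^ 2 * q ^ 2)) :
    -- the map `X = ellipsoidParam p q a b c` is a curvature line parametrization of the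
    -- tri-axial ellipsoid without its four umbilics
    (0 < c ∧ c < b ∧ b < a ∧
      ellipsoidParam p q a b c '' regularDomain p q =
        ellipsoid a b c \ {x | x 0 ^ 2 = (a * p) ^ 2 ∧ x 1 = 0 ∧ x 2 ^ 2 = (c * q) ^ 2} ∧
      IsCurvatureLineParam (ellipsoidParam p q a b c) (regularDomain p q)) ∧
    -- the multi-valued formula has branches on simply connected domains
    (∀ U : Set ℂ, IsOpen U → IsSimplyConnected U → U ⊆ regularDomain p q →
      ∃ Y : ℂ → E3, IsDualBranch p q a b c U Y) ∧
    -- every branch is the Christoffel dual of `X`, which is unique up to scale and translation,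
    -- with the same curvature line parameters
    (∀ (U : Set ℂ) (Y : ℂ → E3), IsDualBranch p q a b c U Y →
      IsChristoffelPair (ellipsoidParam p q a b c) Y U ∧
      IsCurvatureLineParam Y U ∧
      (IsPreconnected U → ∀ Z : ℂ → E3, IsChristoffelPair (ellipsoidParam p q a b c) Z U ↔
        ∃ (s : ℝ) (t : E3), s ≠ 0 ∧ ∀ z ∈ U, Z z = s • Y z + t)) ∧
    -- the surface formed by the branches is the affine image of a Scherk tower
    {x : E3 | ∃ (U : Set ℂ) (Y : ℂ → E3), IsDualBranch p q a b c U Y ∧ x ∈ Y '' U} =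
      scaleAxes a b c '' scherkTower p q := by
  subst hb
  have hp0 := hp.1
  have hq0 := hq.1
  have hr0 := hr.1
  have hrq1 : r * q < 1 := (lt_div_iff₀ hq0).1 hr.2
  have hrq : r ^ 2 * q ^ 2 < 1 := by
    rw [← mul_pow]
    exact pow_lt_one₀ (by positivity) hrq1 two_ne_zero
  have ha2 : a ^ 2 = 1 + r ^ 2 * p ^ 2 := by rw [ha, Real.sq_sqrt (by positivity)]
  have hc2 : c ^ 2 = 1 - r ^ 2 * q ^ 2 := by rw [hc, Real.sq_sqrt (by linarith)]
  have hc0 : 0 < c := by rw [hc]; exact Real.sqrt_pos.2 (by linarith)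
  have hc1 : c < 1 := by
    have : 0 < r ^ 2 * q ^ 2 := by positivity
    exact (sq_lt_one_iff₀ hc0.le).1 (by linarith)
  have ha1 : 1 < a := by
    have h1 : 0 < r ^ 2 * p ^ 2 := by positivity
    exact (one_lt_sq_iff₀ (by rw [ha]; exact Real.sqrt_nonneg _)).1 (by linarith)
  have ha0 : a ≠ 0 := (zero_lt_one.trans ha1).ne'
  exact ⟨⟨hc0, hc1, ha1, image_ellipsoidParam hp hq hpq ha0 one_ne_zero hc0.ne',
      isCurvatureLineParam_ellipsoidParam hp hq hpq hrq ha2 hc2⟩,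
    fun U hU hUs hUΩ => exists_isDualBranch hp hq hpq a one_ne_zero c hU hUs hUΩ,
    fun U Y hY => ⟨hY.isChristoffelPair hp hq hpq hrq ha2 hc2,
      hY.isCurvatureLineParam hp hq hpq hrq ha2 hc2,
      fun hUc Z => hY.isChristoffelPair_iff hp hq hpq hr0.ne' hrq ha0 hc0.ne' ha2 hc2 hUc Z⟩,
    setOf_mem_dualBranch_eq hp hq hpq a one_ne_zero c⟩
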